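/- **Conventions.** Let $p\colon x\to y$ be a morphism of a category $\mathcal C$ such that all pullbacks along $p$ exist. Change of base $p^*\colon\mathcal C\downarrow y\to\mathcal C\downarrow x$ is right adjoint to composition with $p$, written $p_!$. Let $\mathrm{Desc}(p)$ be the category of algebras for the monad $p^*p_!$, and $\mathcal K^p\colon\mathcal C\downarrow y\to\mathrm{Desc}(p)$ the Eilenberg–Moore comparison functor. Then $p$ is an *almost descent morphism* if $\mathcal K^p$ is faithful, a *descent morphism* if $\mathcal K^p$ is fully faithful, and *effective for descent* (an *effective descent morphism*) if $\mathcal K^p$ is an equivalence; each of these includes that pullbacks along $p$ exist. Let $\mathcal S$ be the category generated by the objects $x_0,x_1,x_2,x_3,x_0',x_1',x_2',x_0'',x_1''$ and the arrows - $s_0\colon x_0\to x_1$; $\;s_0,s_1\colon x_1\to x_2$; $\;e_0\colon x_0\to x_0'$; $\;e_1\colon x_1\to x_1'$; - $d_0\colon x_1\to x_0$; $\;d_1\colon x_1\to x_0'$; $\;d_0,d_1\colon x_2\to x_1$; $\;d_2\colon x_2\to x_1'$; $\;d_0,d_1,d_2\colon x_3\to x_2$; $\;d_3\colon x_3\to x_2'$;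 - $s_0'\colon x_0'\to x_1'$; $\;d_0'\colon x_1'\to x_0'$; $\;d_1'\colon x_1'\to x_0''$; $\;d_0',d_1'\colon x_2'\to x_1'$; $\;d_2'\colon x_2'\to x_1''$; $\;d_0''\colon x_1''\to x_0''$; - $m_0\colon x_0''\to x_0'$; $\;m_1\colon x_1''\to x_1'$, subject to the relations - $s_1s_0=s_0s_0\colon x_0\to x_2$; $\;d_1s_0=e_0$ on $x_0$; $\;d_2s_1=e_1$ on $x_1$; - $d_0s_0=\mathrm{id}$ on $x_0$; $\;d_0s_0=d_1s_0=d_1s_1=\mathrm{id}$ on $x_1$; - $d_2s_0=s_0'd_1\colon x_1\to x_1'$; $\;d_0s_1=s_0d_0\colon x_1\to x_1$; $\;d_0's_0'=\mathrm{id}$ on $x_0'$; - for $i=0,1$: $\;d_{1+i}d_{1+i}=m_id'_{1+i}d_{2+i}$ and $d_{1+i}d_0=d_0'd_{2+i}\colon x_{2+i}\to x_i'$; moreover $d_1'd_3=d_2d_1\colon x_3\to x_1'$; - $d_0d_1=d_0d_0\colon x_2\to x_0$; $\;d_jd_{1+i}=d_id_j\colon x_3\to x_1$ for $0\le j\le i\le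 1$; - $d_1'd_0'=d_0''d_2'\colon x_2'\to x_0''$; $\;d_0'd_1'=d_0'd_0'\colon x_2'\to x_0'$. Let $\mathcal B$ be a category with pullbacks and $(T,m,e)$ a cartesian monad on $\mathcal B$ ($T$ preserves pullbacks and the naturality squares of $m$ and $e$ are pullbacks). Let $\mathrm{Mod}(\mathcal S,\mathcal B)$ be the full subcategory of $[\mathcal S,\mathcal B]$ on the functors that send the following three squares to pullback squares: $d_{1+i}d_0=d_0'd_{2+i}$ on $x_{2+i}$, for $i=0,1$, and $d_1'd_0'=d_0''d_2'$ on $x_2'$. Let $\mathcal S_T\subseteq\mathcal S$ be the subcategory on $x_0',x_1',x_2',x_0'',x_1''$ generated by $s_0'$, all the $d'_j$, and $d_0''$. Removing one prime identifies it with the subcategory $\mathcal S_I\subseteq\mathcal S$ on $x_0,x_1,x_2,x_0',x_1'$ generated by $s_0\colon x_0\to x_1$, $d_0,d_1$ on $x_1$, $d_0,d_1,d_2$ on $x_2$, and $d_0'\colon x_1'\to x_0'$. For $i=0,1$ let $\mathcal S_{m_i}$ and $\mathcal S_{e_i}$ be the subcategories consisting of the single arrow $m_i$, respectively $e_i$.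 Write $S_X^*\colon[\mathcal S,\mathcal B]\to[\mathcal S_X,\mathcal B]$ for restriction. Consider the functors $$S^*_-=(S_T^*,S_{m_0}^*,S_{m_1}^*,S_{e_0}^*,S_{e_1}^*),\ \Phi\colon[\mathcal S,\mathcal B]\to[\mathcal S_T,\mathcal B]\times[\mathcal S_{m_0},\mathcal B]\times[\mathcal S_{m_1},\mathcal B]\times[\mathcal S_{e_0},\mathcal B]\times[\mathcal S_{e_1},\mathcal B],$$ where the components of $\Phi$ send $F$ to $T\circ F|_{\mathcal S_I}$ (a diagram on $\mathcal S_T\cong\mathcal S_I$), to $m\colon TTF(x_i)\to TF(x_i)$ ($i=0,1$), and to $e\colon F(x_i)\to TF(x_i)$ ($i=0,1$). Let $\mathcal P$ be the pseudo-equalizer of the restrictions of $S^*_-$ and $\Phi$ to $\mathrm{Mod}(\mathcal S,\mathcal B)$: its objects are pairs $(y,\iota)$ of a model $y$ and an isomorphism $\iota\colon S^*_-y\to\Phi y$, and its morphisms $(y,\iota)\to(z,\kappa)$ are the morphisms $f\colon y\to z$ of models with $\Phi f\circ\iota=\kappa\circ S^*_-f$. **Lemma.** Let $p$ be a morphism in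 $\mathcal P$. If $p$ is effective for descent in $\mathrm{Mod}(\mathcal S,\mathcal B)$ and $S_X^*p$ is a descent morphism in $[\mathcal S_X,\mathcal B]$ for each $X=T,m_0,m_1,e_0,e_1$, then $p$ is effective for descent in $\mathcal P$. In particular, writing $p_i,p_i',p_i''$ for the components of $p$ at $x_i,x_i',x_i''$: if $p_0,p_1,p_0',p_1',p_0'',p_1''$ are effective descent morphisms in $\mathcal B$, $p_2$ and $p_2'$ are descent morphisms in $\mathcal B$, and $p_3$ is an almost descent morphism in $\mathcal B$, then $p$ is effective for descent in $\mathcal P$. -/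

import Mathlib

open CategoryTheory CategoryTheory.Limits

universe v u v₁ u₁ v₂ u₂

namespace IntMulticat

noncomputable section

/-! ### Descent morphisms -/

section Descent

variable {C : Type u} [Category.{v} C] {x y : C}

/-- The comparison functor `C ↓ y ⥤ Desc(p)`, where `Desc(p)` is the category of algebras for the
monad on `C ↓ x` induced by the adjunction `p_! ⊣ p^*` (composition with `p` is left adjoint to
change of base along `p`). -/
abbrev descentComparison (p : x ⟶ y) [HasPullbacksAlong p] :
    Over y ⥤ (Over.mapPullbackAdj p).toMonad.Algebra :=
  Monad.comparison (Over.mapPullbackAdj p)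

/-- `p` is an almost descent morphism: pullbacks along `p` exist and the comparison functor is
faithful. -/
def IsAlmostDescent (p : x ⟶ y) : Prop :=
  ∃ _ : HasPullbacksAlong p, (descentComparison p).Faithful

/-- `p` is a descent morphism: pullbacks along `p` exist and the comparison functor is fully
faithful. -/
def IsDescent (p : x ⟶ y) : Prop :=
  ∃ _ : HasPullbacksAlong p, (descentComparison p).Full ∧ (descentComparison p).Faithful

/-- `p` is an effective descent morphism (is effective for descent): pullbacks along `p` exist and
the comparison functor is an equivalence. -/
def IsEffectiveDescent (p : x ⟶ y) : Prop :=
  ∃ _ : HasPullbacksAlong p, (descentComparison p).IsEquivalence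

end Descent

/-! ### Pseudo-equalizers -/

section PsEq

variable {C : Type u₁} [Category.{v₁} C] {D : Type u₂} [Category.{v₂} D]

/-- The pseudo-equalizer (iso-inserter) of `F` and `G`: objects are pairs `(c, φ)` with
`φ : F c ≅ G c`. -/
structure PsEq (F G : C ⥤ D) where
  /-- the underlying object -/
  obj : C
  /-- the inserted isomorphism -/
  iso : F.obj obj ≅ G.obj obj

namespace PsEq

variable {F G : C ⥤ D}

/-- Morphisms `(c, φ) ⟶ (d, ψ)` are the `f : c ⟶ d` with `G f ∘ φ = ψ ∘ F f`. -/
@[ext]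
structure Hom (X Y : PsEq F G) where
  /-- the underlying morphism -/
  hom : X.obj ⟶ Y.obj
  comm : X.iso.hom ≫ G.map hom = F.map hom ≫ Y.iso.hom

instance : Category (PsEq F G) where
  Hom X Y := Hom X Y
  id X := ⟨𝟙 X.obj, by simp⟩
  comp f g := ⟨f.hom ≫ g.hom, by
    rw [G.map_comp, F.map_comp, ← Category.assoc, f.comm, Category.assoc, g.comm,
      Category.assoc]⟩

end PsEq

end PsEq

/-! ### The sketch of internal multicategories

In the names below, `x0, …, x3` stand for `x₀, …, x₃`, `tx0, tx1, tx2` for `x₀', x₁', x₂'`,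
and `ttx0, ttx1` for `x₀'', x₁''`.  The generator `d i` (or `s i`) with domain `xₙ` is written
`di_n` (or `si_n`), and a prefix `t` or `tt` stands for one or two primes.  Compositions are
written in diagrammatic order. -/

/-- The vertices of the graph of the sketch. -/
inductive Vert : Type
  | x0 | x1 | x2 | x3 | tx0 | tx1 | tx2 | ttx0 | ttx1

open Vert in
/-- The edges of the graph of the sketch. -/
inductive Edge : Vert → Vert → Type
  | s0_0 : Edge x0 x1
  | e_0 : Edge x0 tx0
  | d0_1 : Edge x1 x0
  | d1_1 : Edge x1 tx0
  | s0_1 : Edge x1 x2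
  | s1_1 : Edge x1 x2
  | e_1 : Edge x1 tx1
  | d0_2 : Edge x2 x1
  | d1_2 : Edge x2 x1
  | d2_2 : Edge x2 tx1
  | d0_3 : Edge x3 x2
  | d1_3 : Edge x3 x2
  | d2_3 : Edge x3 x2
  | d3_3 : Edge x3 tx2
  | ts0_0 : Edge tx0 tx1
  | td0_1 : Edge tx1 tx0
  | td1_1 : Edge tx1 ttx0
  | td0_2 : Edge tx2 tx1
  | td1_2 : Edge tx2 tx1
  | td2_2 : Edge tx2 ttx1
  | m_0 : Edge ttx0 tx0
  | ttd0_1 : Edge ttx1 ttx0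
  | m_1 : Edge ttx1 tx1

instance : Quiver Vert := ⟨Edge⟩

/-- An edge as a morphism of the free category on the graph. -/
abbrev Edge.path {a b : Vert} (g : Edge a b) : (Paths.of Vert).obj a ⟶ (Paths.of Vert).obj b :=
  (Paths.of Vert).map g

open Edge in
/-- The relations of the sketch. -/
inductive Rel : HomRel (Paths Vert)
  -- the relation `s₁ s₀ = s₀ s₀ : x₀ ⟶ x₂`
  | s1_s0 : Rel (s0_0.path ≫ s1_1.path) (s0_0.path ≫ s0_1.path)
  -- the relations `d_{1+i} sᵢ = eᵢ : xᵢ ⟶ xᵢ'`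
  | d1_s0 : Rel (s0_0.path ≫ d1_1.path) e_0.path
  | d2_s1 : Rel (s1_1.path ≫ d2_2.path) e_1.path
  -- the relations `dᵢ sⱼ = id` for `j ≤ i ≤ 1`, on `x₀` and on `x₁`
  | d0_s0_0 : Rel (s0_0.path ≫ d0_1.path) (𝟙 _)
  | d0_s0_1 : Rel (s0_1.path ≫ d0_2.path) (𝟙 _)
  | d1_s0_1 : Rel (s0_1.path ≫ d1_2.path) (𝟙 _)
  | d1_s1_1 : Rel (s1_1.path ≫ d1_2.path) (𝟙 _)
  -- the relation `d₂ s₀ = s₀' d₁ : x₁ ⟶ x₁'`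
  | d2_s0 : Rel (s0_1.path ≫ d2_2.path) (d1_1.path ≫ ts0_0.path)
  -- the relation `d₀ s₁ = s₀ d₀ : x₁ ⟶ x₁`
  | d0_s1 : Rel (s1_1.path ≫ d0_2.path) (d0_1.path ≫ s0_0.path)
  -- the relation `d₀' s₀' = id : x₀' ⟶ x₀'`
  | td0_ts0 : Rel (ts0_0.path ≫ td0_1.path) (𝟙 _)
  -- the relations `d_{1+i} d_{1+i} = mᵢ d_{1+i}' d_{2+i} : x_{2+i} ⟶ xᵢ'`
  | d1_d1 : Rel (d1_2.path ≫ d1_1.path) (d2_2.path ≫ td1_1.path ≫ m_0.path)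
  | d2_d2 : Rel (d2_3.path ≫ d2_2.path) (d3_3.path ≫ td2_2.path ≫ m_1.path)
  -- the relations `d_{1+i} d₀ = d₀' d_{2+i} : x_{2+i} ⟶ xᵢ'`
  | d1_d0 : Rel (d0_2.path ≫ d1_1.path) (d2_2.path ≫ td0_1.path)
  | d2_d0 : Rel (d0_3.path ≫ d2_2.path) (d3_3.path ≫ td0_2.path)
  -- the relations `dⱼ' d_{2+i} = d_{1+i} dⱼ : x_{2+i} ⟶ xᵢ'`, `j ≤ i`, not already listed
  | td1_d3 : Rel (d3_3.path ≫ td1_2.path) (d1_3.path ≫ d2_2.path)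
  -- the relation `d₀ d₁ = d₀ d₀ : x₂ ⟶ x₀`
  | d0_d1_2 : Rel (d1_2.path ≫ d0_1.path) (d0_2.path ≫ d0_1.path)
  -- the relations `dⱼ d_{1+i} = dᵢ dⱼ : x₃ ⟶ x₁`, `j ≤ i ≤ 1`
  | d0_d1_3 : Rel (d1_3.path ≫ d0_2.path) (d0_3.path ≫ d0_2.path)
  | d0_d2_3 : Rel (d2_3.path ≫ d0_2.path) (d0_3.path ≫ d1_2.path)
  | d1_d2_3 : Rel (d2_3.path ≫ d1_2.path) (d1_3.path ≫ d1_2.path)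
  -- the relation `d₁' d₀' = d₀'' d₂' : x₂' ⟶ x₀''`
  | td1_td0 : Rel (td0_2.path ≫ td1_1.path) (td2_2.path ≫ ttd0_1.path)
  -- the relation `d₀' d₁' = d₀' d₀' : x₂' ⟶ x₀'`
  | td0_td1 : Rel (td1_2.path ≫ td0_1.path) (td0_2.path ≫ td0_1.path)

/-- The category `𝒮` generated by the graph and the relations. -/
abbrev Sk : Type := CategoryTheory.Quotient Rel

/-- A vertex as an object of `𝒮`. -/
abbrev Sk.ob (a : Vert) : Sk := (CategoryTheory.Quotient.functor Rel).obj ((Paths.of Vert).obj a)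

/-- An edge as a morphism of `𝒮`. -/
abbrev Sk.arr {a b : Vert} (g : Edge a b) : Sk.ob a ⟶ Sk.ob b :=
  (CategoryTheory.Quotient.functor Rel).map g.path

/-! The subcategory `𝒮_T` of `𝒮`, on the primed and doubly primed objects. -/

/-- The vertices `x₀', x₁', x₂', x₀'', x₁''` of `𝒮_T`. -/
inductive TVert : Type
  | tx0 | tx1 | tx2 | ttx0 | ttx1

open TVert in
/-- The generating arrows of `𝒮_T`. -/
inductive TEdge : TVert → TVert → Type
  | ts0_0 : TEdge tx0 tx1
  | td0_1 : TEdge tx1 tx0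
  | td1_1 : TEdge tx1 ttx0
  | td0_2 : TEdge tx2 tx1
  | td1_2 : TEdge tx2 tx1
  | td2_2 : TEdge tx2 ttx1
  | ttd0_1 : TEdge ttx1 ttx0

instance : Quiver TVert := ⟨TEdge⟩

/-- A generating arrow as a morphism of the free category. -/
abbrev TEdge.path {a b : TVert} (g : TEdge a b) :
    (Paths.of TVert).obj a ⟶ (Paths.of TVert).obj b :=
  (Paths.of TVert).map g

open TEdge in
/-- The relations which hold between the generating arrows of `𝒮_T`. -/
inductive TRel : HomRel (Paths TVert)
  | td0_ts0 : TRel (ts0_0.path ≫ td0_1.path) (𝟙 _)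
  | td1_td0 : TRel (td0_2.path ≫ td1_1.path) (td2_2.path ≫ ttd0_1.path)
  | td0_td1 : TRel (td1_2.path ≫ td0_1.path) (td0_2.path ≫ td0_1.path)

/-- The category `𝒮_T`. -/
abbrev SkT : Type := CategoryTheory.Quotient TRel

/-- The inclusion `𝒮_T ⥤ 𝒮` on objects. -/
def TVert.incl : TVert → Vert
  | .tx0 => .tx0
  | .tx1 => .tx1
  | .tx2 => .tx2
  | .ttx0 => .ttx0
  | .ttx1 => .ttx1

/-- The inclusion `𝒮_T ⥤ 𝒮` on generating arrows. -/
def TEdge.incl : ∀ {a b : TVert}, TEdge a b → Edge a.incl b.incl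
  | _, _, .ts0_0 => .ts0_0
  | _, _, .td0_1 => .td0_1
  | _, _, .td1_1 => .td1_1
  | _, _, .td0_2 => .td0_2
  | _, _, .td1_2 => .td1_2
  | _, _, .td2_2 => .td2_2
  | _, _, .ttd0_1 => .ttd0_1

/-- The inclusion `𝒮_T ⥤ 𝒮`. -/
def inclT : SkT ⥤ Sk :=
  CategoryTheory.Quotient.lift TRel
    (Paths.lift { obj := fun a => Sk.ob a.incl, map := fun g => Sk.arr (TEdge.incl g) }) (by
      rintro _ _ _ _ (_ | _ | _) <;> simp only [Paths.of_map]
      · exact CategoryTheory.Quotient.sound Rel Rel.td0_ts0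
      · exact CategoryTheory.Quotient.sound Rel Rel.td1_td0
      · exact CategoryTheory.Quotient.sound Rel Rel.td0_td1)

/-! The subcategory `𝒮_I` of `𝒮`, on `x₀, x₁, x₂, x₀', x₁'`, is isomorphic to `𝒮_T`: the
isomorphism `𝒮_T ≅ 𝒮_I` removes one prime from every object and from every generating arrow. -/

/-- The composite `𝒮_T ≅ 𝒮_I ⥤ 𝒮` on objects. -/
def TVert.unprime : TVert → Vert
  | .tx0 => .x0
  | .tx1 => .x1
  | .tx2 => .x2
  | .ttx0 => .tx0
  | .ttx1 => .tx1

/-- The composite `𝒮_T ≅ 𝒮_I ⥤ 𝒮` on generating arrows. -/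
def TEdge.unprime : ∀ {a b : TVert}, TEdge a b → Edge a.unprime b.unprime
  | _, _, .ts0_0 => .s0_0
  | _, _, .td0_1 => .d0_1
  | _, _, .td1_1 => .d1_1
  | _, _, .td0_2 => .d0_2
  | _, _, .td1_2 => .d1_2
  | _, _, .td2_2 => .d2_2
  | _, _, .ttd0_1 => .td0_1

/-- The isomorphism `𝒮_T ≅ 𝒮_I` that removes one prime, followed by the inclusion `𝒮_I ⥤ 𝒮`. -/
def inclI : SkT ⥤ Sk :=
  CategoryTheory.Quotient.lift TRel
    (Paths.lift { obj := fun a => Sk.ob a.unprime, map := fun g => Sk.arr (TEdge.unprime g) }) (by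
      rintro _ _ _ _ (_ | _ | _) <;> simp only [Paths.of_map]
      · exact CategoryTheory.Quotient.sound Rel Rel.d0_s0_0
      · exact CategoryTheory.Quotient.sound Rel Rel.d1_d0
      · exact CategoryTheory.Quotient.sound Rel Rel.d0_d1_2)

/-! ### Models of the sketch -/

section Models

variable (B : Type u) [Category.{v} B]

/-- A functor `𝒮 ⥤ B` is a model if it sends the three distinguished squares to pullbacks. -/
def IsModel : ObjectProperty (Sk ⥤ B) := fun F =>
  IsPullback (F.map (Sk.arr .d0_2)) (F.map (Sk.arr .d2_2))
    (F.map (Sk.arr .d1_1)) (F.map (Sk.arr .td0_1)) ∧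
  IsPullback (F.map (Sk.arr .d0_3)) (F.map (Sk.arr .d3_3))
    (F.map (Sk.arr .d2_2)) (F.map (Sk.arr .td0_2)) ∧
  IsPullback (F.map (Sk.arr .td0_2)) (F.map (Sk.arr .td2_2))
    (F.map (Sk.arr .td1_1)) (F.map (Sk.arr .ttd0_1))

/-- `Mod(𝒮, B)`, the full subcategory of `[𝒮, B]` on the models. -/
abbrev Mod : Type _ := (IsModel B).FullSubcategory

/-- Restriction to `𝒮_T`. -/
abbrev resT : (Sk ⥤ B) ⥤ (SkT ⥤ B) := (Functor.whiskeringLeft SkT Sk B).obj inclT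

/-- Restriction to a subcategory of `𝒮` that consists of a single arrow `g`; a diagram of that
shape is an object of the arrow category. -/
def resArrow {a b : Vert} (g : Edge a b) : (Sk ⥤ B) ⥤ Arrow B where
  obj F := Arrow.mk (F.map (Sk.arr g))
  map α := Arrow.homMk (α.app _) (α.app _) (α.naturality _).symm

/-- The product `[𝒮_T, B] × [𝒮_{m₀}, B] × [𝒮_{m₁}, B] × [𝒮_{e₀}, B] × [𝒮_{e₁}, B]`. -/
abbrev Diagrams : Type _ := (SkT ⥤ B) × Arrow B × Arrow B × Arrow B × Arrow B

/-- The functor `S^*` from `[𝒮, B]` to the product, whose components are the restrictions to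
`𝒮_T`, `𝒮_{m₀}`, `𝒮_{m₁}`, `𝒮_{e₀}` and `𝒮_{e₁}`. -/
abbrev resAll : (Sk ⥤ B) ⥤ Diagrams B :=
  (resT B).prod' ((resArrow B .m_0).prod' ((resArrow B .m_1).prod'
    ((resArrow B .e_0).prod' (resArrow B .e_1))))

variable {B}

/-- A cartesian monad: the functor preserves pullbacks, and the naturality squares of the unit and
of the multiplication are pullbacks. -/
structure IsCartesianMonad (T : CategoryTheory.Monad B) : Prop where
  preserves : PreservesLimitsOfShape WalkingCospan (T : B ⥤ B)
  unit : ∀ {a b : B} (f : a ⟶ b),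
    IsPullback (T.η.app a) f ((T : B ⥤ B).map f) (T.η.app b)
  mult : ∀ {a b : B} (f : a ⟶ b),
    IsPullback (T.μ.app a) ((T : B ⥤ B).map ((T : B ⥤ B).map f))
      ((T : B ⥤ B).map f) (T.μ.app b)

variable (T : CategoryTheory.Monad B)

/-- The functor `B ⥤ [𝒮_{mᵢ}, B]` sending `b` to `m : TTb ⟶ Tb`. -/
def multArrow : B ⥤ Arrow B where
  obj b := Arrow.mk (T.μ.app b)
  map f := Arrow.homMk ((T : B ⥤ B).map ((T : B ⥤ B).map f)) ((T : B ⥤ B).map f)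
    (T.μ.naturality f)

/-- The functor `B ⥤ [𝒮_{eᵢ}, B]` sending `b` to `e : b ⟶ Tb`. -/
def unitArrow : B ⥤ Arrow B where
  obj b := Arrow.mk (T.η.app b)
  map f := Arrow.homMk f ((T : B ⥤ B).map f) (T.η.naturality f)

/-- The component of `Φ` at `𝒮_T`: restrict to `𝒮_I`, regard the result as a diagram on
`𝒮_T ≅ 𝒮_I`, and apply `T`. -/
abbrev shiftT : (Sk ⥤ B) ⥤ (SkT ⥤ B) :=
  (Functor.whiskeringLeft SkT Sk B).obj inclI ⋙ (Functor.whiskeringRight SkT B B).obj (T : B ⥤ B)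

/-- The functor `Φ`. -/
abbrev Phi : (Sk ⥤ B) ⥤ Diagrams B :=
  (shiftT T).prod'
    (((evaluation Sk B).obj (Sk.ob .x0) ⋙ multArrow T).prod'
      (((evaluation Sk B).obj (Sk.ob .x1) ⋙ multArrow T).prod'
        (((evaluation Sk B).obj (Sk.ob .x0) ⋙ unitArrow T).prod'
          ((evaluation Sk B).obj (Sk.ob .x1) ⋙ unitArrow T))))

/-- The category `𝒫`, the pseudo-equalizer of `S^*` and `Φ` restricted to `Mod(𝒮, B)`. -/
abbrev P : Type _ := PsEq ((IsModel B).ι ⋙ resAll B) ((IsModel B).ι ⋙ Phi T)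

variable {T}

/-- The morphism of models underlying a morphism of `𝒫`. -/
abbrev modHom {X Y : P T} (p : X ⟶ Y) : X.obj ⟶ Y.obj := PsEq.Hom.hom p

/-- The natural transformation underlying a morphism of `𝒫`. -/
abbrev diagHom {X Y : P T} (p : X ⟶ Y) : X.obj.obj ⟶ Y.obj.obj := (IsModel B).ι.map (modHom p)

/-- The component at a vertex of a morphism of `𝒫`. -/
abbrev component {X Y : P T} (p : X ⟶ Y) (a : Vert) :
    X.obj.obj.obj (Sk.ob a) ⟶ Y.obj.obj.obj (Sk.ob a) :=
  (diagHom p).app (Sk.ob a)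

end Models

end

end IntMulticat

/-!
# Effective descent for morphisms of the pseudo-equalizer `𝒫`

*Elementary descent.* Write `q : p^* A ⟶ A` for the base change of `p : x ⟶ y` along an object `A`
over `y`. The action of the monad `p^* p_!` on `p^* A` is the second projection of the kernel pair
of `q`, so a morphism of algebras `p^* A ⟶ p^* B` is the same thing as a morphism `p^* A ⟶ B` over
`y` that coequalizes the kernel pair of `q`. Hence the comparison functor is faithful if and only
if morphisms over `y` are detected by every such `q` (`MapsDetected`), it is moreover full if and
only if every such `q` is the coequalizer of its kernel pair over `y` (`MapsDescend`), and
essential surjectivity says that every action comes from a base change (`DataDescend`). None of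
these conditions refers to chosen pullbacks, so functors that preserve pullbacks transport them.

*Pseudo-equalizers.* Let `F, G : M ⥤ N` preserve pullbacks and let `p` be a morphism of `PsEq F G`
that is effective for descent in `M`. A morphism obtained by descent in `M` is compatible with the
inserted isomorphisms, because this can be tested after a base change of `F p`, and an object `D`
obtained by descent in `M` along `q : c₀ ⟶ D` carries an inserted isomorphism: `F q` and `G q` are
both base changes of `F p`, up to the inserted isomorphisms, so that the isomorphism `F c₀ ≅ G c₀`
and its inverse descend (`PsEq.isEffectiveDescent`). Both `S^*` and `Φ` preserve pullbacks since
`T` does, and descent in a product is componentwise; this is the first claim.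

*Models.* In `[J, B]` pullbacks are objectwise, and morphisms obtained objectwise by descent are
automatically natural, as they are unique. For the same reason, objects obtained objectwise form a
functor as soon as the action of every morphism of `J` descends (`exists_functor`). For models of
the sketch the objects at `x₂`, `x₂'` and `x₃` need not be obtained by descent, as they are
pullbacks of the others, and a morphism into `x₂` descends along a mere almost descent morphism
once its composites with the projections do; this suffices for the arrows out of `x₃`
(`dataDescend_mod`). With the analogous statement for arrow categories, the second claim follows
from the first.
-/

namespace IntMulticat

noncomputable section

/-! ### Elementary descent -/

section Elementary

variable {C : Type u} [Category.{v} C] {x y : C}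

/-- The elementary form of faithfulness of the comparison functor of `p`: morphisms over `y` are
detected by precomposition with the base changes of `p`. -/
def MapsDetected (p : x ⟶ y) : Prop :=
  ∀ ⦃A P Z : C⦄ ⦃q : P ⟶ A⦄ ⦃π : P ⟶ x⦄ ⦃a : A ⟶ y⦄, IsPullback q π a p →
    ∀ ⦃z : Z ⟶ y⦄ ⦃f g : A ⟶ Z⦄, f ≫ z = a → g ≫ z = a → q ≫ f = q ≫ g → f = g

/-- The elementary form of fullness of the comparison functor of `p`: a morphism over `y` out of
the domain of a base change `q` of `p` factors through `q` once it identifies every pair of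
generalized elements that `q` identifies. Testing on all pairs avoids a choice of kernel pair. -/
def MapsDescend (p : x ⟶ y) : Prop :=
  ∀ ⦃A P Z : C⦄ ⦃q : P ⟶ A⦄ ⦃π : P ⟶ x⦄ ⦃a : A ⟶ y⦄, IsPullback q π a p →
    ∀ ⦃z : Z ⟶ y⦄ (ψ : P ⟶ Z), ψ ≫ z = q ≫ a →
      (∀ ⦃R : C⦄ (r₁ r₂ : R ⟶ P), r₁ ≫ q = r₂ ≫ q → r₁ ≫ ψ = r₂ ≫ ψ) →
      ∃ f : A ⟶ Z, q ≫ f = ψ ∧ f ≫ z = a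

/-- A descent datum for `p : x ⟶ y` on `c : c₀ ⟶ x`, i.e. an algebra structure for the monad
`p^* p_!`, with an arbitrary pullback `R` of `c ≫ p` along `p` in place of the chosen one: `r₁` is
the projection and `r₂` the action. The two laws of the action say that `(r₁, r₂)` is a reflexive
and transitive relation on `c₀`. -/
structure DescentDatum (p : x ⟶ y) {c₀ : C} (c : c₀ ⟶ x) where
  /-- the domain of the action -/
  R : C
  /-- the projection -/
  r₁ : R ⟶ c₀
  /-- the action -/
  r₂ : R ⟶ c₀
  isPullback : IsPullback r₁ (r₂ ≫ c) (c ≫ p) p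
  refl : ∃ i : c₀ ⟶ R, i ≫ r₁ = 𝟙 c₀ ∧ i ≫ r₂ = 𝟙 c₀
  trans : ∀ ⦃S : C⦄ (s t : S ⟶ R), s ≫ r₂ = t ≫ r₁ →
    ∃ w : S ⟶ R, w ≫ r₁ = s ≫ r₁ ∧ w ≫ r₂ = t ≫ r₂

/-- `D`, with `d : D ⟶ y` and `q : c₀ ⟶ D`, is a solution of the descent problem posed by `𝔡`. -/
structure DescentDatum.IsSolution {p : x ⟶ y} {c₀ : C} {c : c₀ ⟶ x} (𝔡 : DescentDatum p c)
    {D : C} (d : D ⟶ y) (q : c₀ ⟶ D) : Prop where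
  isPullback : IsPullback q c d p
  w : 𝔡.r₁ ≫ q = 𝔡.r₂ ≫ q

lemma DescentDatum.hom_ext {c₀ : C} {c : c₀ ⟶ x} (𝔡 : DescentDatum p c) {S : C} {s t : S ⟶ 𝔡.R}
    (h₁ : s ≫ 𝔡.r₁ = t ≫ 𝔡.r₁) (h₂ : s ≫ 𝔡.r₂ = t ≫ 𝔡.r₂) : s = t :=
  𝔡.isPullback.hom_ext h₁ (by rw [reassoc_of% h₂])

/-- The elementary form of essential surjectivity of the comparison functor of `p`. -/
def DataDescend (p : x ⟶ y) : Prop :=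
  ∀ ⦃c₀ : C⦄ ⦃c : c₀ ⟶ x⦄ (𝔡 : DescentDatum p c), ∃ (D : C) (d : D ⟶ y) (q : c₀ ⟶ D),
    𝔡.IsSolution d q

section Comparison

variable (p : x ⟶ y) [HasPullbacksAlong p]

/-- The monad `p^* p_!`. -/
abbrev descentMonad : CategoryTheory.Monad (Over x) := (Over.mapPullbackAdj p).toMonad

/-- The projection `p^* p_! A ⟶ A`. -/
def monadProj (A : Over x) : ((descentMonad p).obj A).left ⟶ A.left :=
  pullback.fst (A.hom ≫ p) p

/-- The projection `p^* A ⟶ A`. -/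
def comparisonProj (A : Over y) : ((descentComparison p).obj A).A.left ⟶ A.left :=
  pullback.fst A.hom p

lemma isPullback_monadProj (A : Over x) :
    IsPullback (monadProj p A) ((descentMonad p).obj A).hom (A.hom ≫ p) p :=
  IsPullback.of_hasPullback (A.hom ≫ p) p

lemma isPullback_comparisonProj (A : Over y) :
    IsPullback (comparisonProj p A) ((descentComparison p).obj A).A.hom A.hom p :=
  IsPullback.of_hasPullback A.hom p

lemma map_left_monadProj {A B : Over x} (f : A ⟶ B) :
    ((descentMonad p).map f).left ≫ monadProj p B = monadProj p A ≫ f.left :=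
  pullback.lift_fst _ _ _

lemma map_left_monadProj_assoc {A B : Over x} (f : A ⟶ B) {Z : C} (h : B.left ⟶ Z) :
    ((descentMonad p).map f).left ≫ monadProj p B ≫ h = monadProj p A ≫ f.left ≫ h := by
  rw [← Category.assoc, map_left_monadProj, Category.assoc]

lemma unit_left_monadProj (A : Over x) :
    ((descentMonad p).η.app A).left ≫ monadProj p A = 𝟙 A.left :=
  pullback.lift_fst _ _ _

lemma mult_left_monadProj (A : Over x) :
    ((descentMonad p).μ.app A).left ≫ monadProj p A =
      monadProj p ((descentMonad p).obj A) ≫ monadProj p A := by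
  refine (pullback.lift_fst _ _ _).trans ?_
  exact congrArg (monadProj p ((descentMonad p).obj A) ≫ ·)
    ((congrArg Over.Hom.left (Over.mapPullbackAdj_counit_app p ((Over.map p).obj A))).trans rfl)

lemma comparison_map_left_proj {A B : Over y} (f : A ⟶ B) :
    ((descentComparison p).map f).f.left ≫ comparisonProj p B = comparisonProj p A ≫ f.left :=
  pullback.lift_fst _ _ _

/-- The action of `p^* p_!` on `p^* A` and the projection form the kernel pair of `p^* A ⟶ A`. -/
lemma comparison_obj_a_left_proj (A : Over y) :
    ((descentComparison p).obj A).a.left ≫ comparisonProj p A =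
      monadProj p ((descentComparison p).obj A).A ≫ comparisonProj p A := by
  refine (pullback.lift_fst _ _ _).trans ?_
  exact congrArg (monadProj p ((descentComparison p).obj A).A ≫ ·)
    ((congrArg Over.Hom.left (Over.mapPullbackAdj_counit_app p A)).trans rfl)

lemma comparison_map_eq_iff {A B : Over y} (f g : A ⟶ B) :
    (descentComparison p).map f = (descentComparison p).map g ↔
      comparisonProj p A ≫ f.left = comparisonProj p A ≫ g.left := by
  rw [← comparison_map_left_proj, ← comparison_map_left_proj]
  refine ⟨fun h => by rw [h], fun h => ?_⟩
  ext
  refine (isPullback_comparisonProj p B).hom_ext h ?_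
  rw [Over.w, Over.w]

lemma faithful_descentComparison_iff : (descentComparison p).Faithful ↔ MapsDetected p := by
  constructor
  · intro _ A P Z q π a hq z f g hf hg hfg
    have key : (Over.homMk f hf : Over.mk a ⟶ Over.mk z) = Over.homMk g hg := by
      apply (descentComparison p).map_injective
      rw [comparison_map_eq_iff]
      obtain ⟨l, hl, -⟩ := hq.exists_lift _ _ (isPullback_comparisonProj p (Over.mk a)).w
      rw [← hl, Category.assoc, Category.assoc]
      exact congrArg (l ≫ ·) hfg
    exact congrArg Over.Hom.left key
  · intro h
    refine ⟨fun {A B f g} hfg => ?_⟩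
    rw [comparison_map_eq_iff] at hfg
    ext
    exact h (isPullback_comparisonProj p A) (Over.w f) (Over.w g) hfg

/-- A morphism `φ : p^* A ⟶ p^* B` over `x` is a morphism of algebras if and only if its
composite with the projection to `B` coequalizes the kernel pair of the projection to `A`. -/
lemma algebraHom_iff {A B : Over y}
    (φ : ((descentComparison p).obj A).A ⟶ ((descentComparison p).obj B).A) :
    (descentMonad p).map φ ≫ ((descentComparison p).obj B).a =
        ((descentComparison p).obj A).a ≫ φ ↔
      monadProj p ((descentComparison p).obj A).A ≫ φ.left ≫ comparisonProj p B =
        ((descentComparison p).obj A).a.left ≫ φ.left ≫ comparisonProj p B := by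
  rw [← map_left_monadProj_assoc, ← comparison_obj_a_left_proj]
  constructor
  · intro h
    have h' := congrArg (fun k => Over.Hom.left k ≫ comparisonProj p B) h
    rwa [Over.comp_left, Over.comp_left, Category.assoc, Category.assoc] at h'
  · intro h
    ext
    refine (isPullback_comparisonProj p B).hom_ext ?_ ?_
    · rwa [Over.comp_left, Over.comp_left, Category.assoc, Category.assoc]
    · rw [Over.w, Over.w]

lemma full_descentComparison_iff [(descentComparison p).Faithful] :
    (descentComparison p).Full ↔ MapsDescend p := by
  constructor
  · intro _ A P Z q π a hq z ψ hψ hr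
    obtain ⟨e, he₁, he₂⟩ :=
      hq.exists_lift _ _ (isPullback_comparisonProj p (Over.mk a)).w
    obtain ⟨φ, hφ₁, hφ₂⟩ := (isPullback_comparisonProj p (Over.mk z)).exists_lift
      (e ≫ ψ) ((descentComparison p).obj (Over.mk a)).A.hom (by
        rw [← he₂, Category.assoc, Category.assoc, ← hq.w, ← hψ]; rfl)
    let φ' : ((descentComparison p).obj (Over.mk a)).A ⟶
      ((descentComparison p).obj (Over.mk z)).A := Over.homMk φ hφ₂
    have hφ' : φ'.left ≫ comparisonProj p (Over.mk z) = e ≫ ψ := hφ₁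
    obtain ⟨f, hf⟩ := (descentComparison p).map_surjective
      (⟨φ', (algebraHom_iff p φ').2 (by
        rw [hφ', ← Category.assoc, ← Category.assoc]
        refine hr _ _ ?_
        rw [Category.assoc, Category.assoc, he₁, comparison_obj_a_left_proj])⟩ :
        (descentComparison p).obj (Over.mk a) ⟶ (descentComparison p).obj (Over.mk z))
    refine ⟨f.left, ?_, Over.w f⟩
    have h₁ := comparison_map_left_proj p f
    rw [hf] at h₁
    obtain ⟨e', he'₁, he'₂⟩ := (isPullback_comparisonProj p (Over.mk a)).exists_lift _ _ hq.w
    have hee : e' ≫ e = 𝟙 P := hq.hom_ext (by simp [he₁, he'₁]) (by simp [he₂, he'₂])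
    calc q ≫ f.left = e' ≫ comparisonProj p (Over.mk a) ≫ f.left := by
          rw [← he'₁, Category.assoc]
      _ = e' ≫ e ≫ ψ := by rw [← h₁]; exact congrArg (e' ≫ ·) hφ'
      _ = ψ := by rw [← Category.assoc, hee, Category.id_comp]
  · intro h
    refine ⟨fun {A B} φ => ?_⟩
    have hφ := (algebraHom_iff p φ.f).1 φ.h
    obtain ⟨f, hf₁, hf₂⟩ := h (isPullback_comparisonProj p A)
      (φ.f.left ≫ comparisonProj p B) (z := B.hom) (by
        rw [Category.assoc, (isPullback_comparisonProj p B).w, ← Category.assoc, Over.w,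
          (isPullback_comparisonProj p A).w])
      (fun R r₁ r₂ hr => by
        -- the pair `(r₁, r₂)` factors through the kernel pair of the projection
        obtain ⟨l, hl₁, hl₂⟩ := (isPullback_monadProj p
          ((descentComparison p).obj A).A).exists_lift r₁
            (r₂ ≫ ((descentComparison p).obj A).A.hom) (by
            rw [Category.assoc, ← (isPullback_comparisonProj p A).w, reassoc_of% hr])
        have hl₃ : l ≫ ((descentComparison p).obj A).a.left = r₂ := by
          refine (isPullback_comparisonProj p A).hom_ext ?_ ?_
          · rw [Category.assoc, comparison_obj_a_left_proj, reassoc_of% hl₁, hr]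
          · rw [Category.assoc, Over.w, hl₂]
        rw [← hl₁, ← hl₃, Category.assoc, Category.assoc, hφ])
    refine ⟨Over.homMk f hf₂, ?_⟩
    ext
    refine (isPullback_comparisonProj p B).hom_ext ?_ ?_
    · rw [comparison_map_left_proj]; exact hf₁
    · rw [Over.w, Over.w]

/-- The descent datum of an algebra for the monad `p^* p_!`. -/
def descentDatumOfAlgebra (A : (descentMonad p).Algebra) :
    DescentDatum p A.A.hom where
  R := ((descentMonad p).obj A.A).left
  r₁ := monadProj p A.A
  r₂ := A.a.left
  isPullback := by rw [Over.w]; exact isPullback_monadProj p A.A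
  refl := ⟨((descentMonad p).η.app A.A).left, unit_left_monadProj p A.A,
    congrArg Over.Hom.left A.unit⟩
  trans S s t h := by
    obtain ⟨l, hl₁, hl₂⟩ := (isPullback_monadProj p ((descentMonad p).obj A.A)).exists_lift s
      (t ≫ ((descentMonad p).obj A.A).hom) (by
        rw [← Over.w A.a, Category.assoc, Category.assoc, reassoc_of% h,
          (isPullback_monadProj p A.A).w, Category.assoc, Over.w_assoc])
    have ht : l ≫ ((descentMonad p).map A.a).left = t := by
      refine (isPullback_monadProj p A.A).hom_ext ?_ ?_
      · rw [Category.assoc, map_left_monadProj, reassoc_of% hl₁, h]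
      · rw [Category.assoc, Over.w]; exact hl₂
    refine ⟨l ≫ ((descentMonad p).μ.app A.A).left, ?_, ?_⟩
    · rw [Category.assoc, mult_left_monadProj, reassoc_of% hl₁]
    · have := congrArg Over.Hom.left A.assoc
      rw [Over.comp_left, Over.comp_left] at this
      rw [Category.assoc, this, reassoc_of% ht]

variable {p}

/-- The structure morphism of the algebra of a descent datum. -/
def DescentDatum.action {c₀ : C} {c : c₀ ⟶ x} (𝔡 : DescentDatum p c) :
    (descentMonad p).obj (Over.mk c) ⟶ Over.mk c :=
  Over.homMk (𝔡.isPullback.lift (monadProj p (Over.mk c)) _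
      (isPullback_monadProj p (Over.mk c)).w ≫ 𝔡.r₂)
    (by simp [𝔡.isPullback.lift_snd])

lemma DescentDatum.exists_lift_action {c₀ : C} {c : c₀ ⟶ x} (𝔡 : DescentDatum p c) :
    ∃ l : ((descentMonad p).obj (Over.mk c)).left ⟶ 𝔡.R,
      l ≫ 𝔡.r₁ = monadProj p (Over.mk c) ∧ l ≫ 𝔡.r₂ = 𝔡.action.left :=
  ⟨_, 𝔡.isPullback.lift_fst _ _ _, rfl⟩

/-- The algebra of a descent datum. -/
def DescentDatum.algebra {c₀ : C} {c : c₀ ⟶ x} (𝔡 : DescentDatum p c) :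
    (descentMonad p).Algebra where
  A := Over.mk c
  a := 𝔡.action
  unit := by
    ext
    obtain ⟨l, hl₁, hl₂⟩ := 𝔡.exists_lift_action
    obtain ⟨i, hi₁, hi₂⟩ := 𝔡.refl
    rw [Over.comp_left, ← hl₂, ← Category.assoc]
    refine Eq.trans (congrArg (· ≫ 𝔡.r₂) ?_) hi₂
    refine 𝔡.isPullback.hom_ext ?_ ?_
    · rw [Category.assoc, hl₁, unit_left_monadProj, hi₁]; rfl
    · rw [Category.assoc, reassoc_of% hl₂, reassoc_of% hi₂]
      erw [Over.w 𝔡.action, Over.w ((descentMonad p).η.app (Over.mk c))]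
      rfl
  assoc := by
    ext
    obtain ⟨l, hl₁, hl₂⟩ := 𝔡.exists_lift_action
    -- the two composites are the two sides of the transitivity law at `s` and `t`
    obtain ⟨w, hw₁, hw₂⟩ := 𝔡.trans (monadProj p ((descentMonad p).obj (Over.mk c)) ≫ l)
      (((descentMonad p).map 𝔡.action).left ≫ l) (by
        rw [Category.assoc, Category.assoc, hl₁, hl₂, map_left_monadProj])
    rw [Over.comp_left, Over.comp_left, ← hl₂]
    rw [Category.assoc] at hw₂
    refine Eq.trans ?_ hw₂
    rw [← Category.assoc]
    refine congrArg (· ≫ 𝔡.r₂) (𝔡.isPullback.hom_ext ?_ ?_)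
    · rw [hw₁, Category.assoc, Category.assoc, hl₁, mult_left_monadProj]
    · rw [reassoc_of% hw₂, Category.assoc, reassoc_of% hl₂]
      erw [Over.w 𝔡.action, Over.w ((descentMonad p).map 𝔡.action),
        Over.w ((descentMonad p).μ.app (Over.mk c))]
      rfl

variable (p)

/-- An algebra is in the essential image of the comparison functor if its descent datum has a
solution. -/
def comparisonIso (A : (descentMonad p).Algebra) {D : C} {d : D ⟶ y}
    {q : A.A.left ⟶ D} (hq : IsPullback q A.A.hom d p)
    (h : monadProj p A.A ≫ q = A.a.left ≫ q) :
    (descentComparison p).obj (Over.mk d) ≅ A :=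
  Monad.Algebra.isoMk
    (Over.isoMk ((isPullback_comparisonProj p (Over.mk d)).isoIsPullback _ _ hq)
      (IsPullback.isoIsPullback_hom_snd _ _ _ _)) (by
    ext
    refine hq.hom_ext ?_ ?_
    · rw [Over.comp_left, Over.comp_left, Category.assoc, Category.assoc]
      have hl : Over.Hom.left (Over.isoMk
          ((isPullback_comparisonProj p (Over.mk d)).isoIsPullback _ _ hq)
          (IsPullback.isoIsPullback_hom_snd _ _ _ _) :
          ((descentComparison p).obj (Over.mk d)).A ≅ A.A).hom ≫ q =
            comparisonProj p (Over.mk d) :=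
        IsPullback.isoIsPullback_hom_fst _ _ _ _
      rw [hl, comparison_obj_a_left_proj, ← h, map_left_monadProj_assoc, hl]
    · rw [Over.w, Over.w])

/-- An algebra in the essential image of the comparison functor is a base change of an object
over `y`, compatibly with the actions. -/
lemma exists_isPullback_of_iso {A : (descentMonad p).Algebra} {D : Over y}
    (e : (descentComparison p).obj D ≅ A) :
    ∃ (D : C) (d : D ⟶ y) (q : A.A.left ⟶ D), IsPullback q A.A.hom d p ∧
      monadProj p A.A ≫ q = A.a.left ≫ q := by
  have hinv : e.hom.f.left ≫ e.inv.f.left = 𝟙 _ :=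
    congrArg (fun k => Over.Hom.left (Monad.Algebra.Hom.f k)) e.hom_inv_id
  have hhom : e.inv.f.left ≫ e.hom.f.left = 𝟙 _ :=
    congrArg (fun k => Over.Hom.left (Monad.Algebra.Hom.f k)) e.inv_hom_id
  refine ⟨D.left, D.hom, e.inv.f.left ≫ comparisonProj p D, ?_, ?_⟩
  · refine (isPullback_comparisonProj p D).of_iso
      ⟨e.hom.f.left, e.inv.f.left, hinv, hhom⟩ (Iso.refl _) (Iso.refl _) (Iso.refl _) ?_ ?_ ?_ ?_
    · rw [reassoc_of% hinv]; exact Category.comp_id _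
    · exact (Category.comp_id _).trans (Over.w e.hom.f).symm
    · simp
    · simp
  · have h₁ := congrArg Over.Hom.left e.inv.h
    rw [Over.comp_left, Over.comp_left] at h₁
    rw [← map_left_monadProj_assoc, ← comparison_obj_a_left_proj]
    exact (Category.assoc _ _ _).symm.trans
      ((congrArg (· ≫ comparisonProj p D) h₁).trans (Category.assoc _ _ _))

lemma isEquivalence_descentComparison_iff : (descentComparison p).IsEquivalence ↔
    MapsDetected p ∧ MapsDescend p ∧ DataDescend p := by
  constructor
  · intro _
    refine ⟨(faithful_descentComparison_iff p).1 inferInstance,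
      (full_descentComparison_iff p).1 inferInstance, fun c₀ c 𝔡 => ?_⟩
    obtain ⟨D, d, q, hq, h⟩ := exists_isPullback_of_iso p
      ((descentComparison p).objObjPreimageIso 𝔡.algebra)
    obtain ⟨l, hl₁, hl₂⟩ := 𝔡.exists_lift_action
    obtain ⟨l', hl'₁, hl'₂⟩ := (isPullback_monadProj p (Over.mk c)).exists_lift _ _
      𝔡.isPullback.w
    have hl' : l' ≫ 𝔡.action.left = 𝔡.r₂ := by
      rw [← hl₂, ← Category.assoc]
      refine Eq.trans (congrArg (· ≫ 𝔡.r₂) ?_) (Category.id_comp _)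
      refine 𝔡.isPullback.hom_ext ?_ ?_
      · rw [Category.assoc, hl₁, hl'₁, Category.id_comp]
      · rw [Category.assoc, reassoc_of% hl₂, Category.id_comp, ← hl'₂]
        exact congrArg (l' ≫ ·) (Over.w 𝔡.action)
    refine ⟨D, d, q, hq, ?_⟩
    rw [← hl'₁, ← hl']
    exact (Category.assoc _ _ _).trans
      ((congrArg (l' ≫ ·) h).trans (Category.assoc _ _ _).symm)
  · rintro ⟨h₁, h₂, h₃⟩
    have h₁' := (faithful_descentComparison_iff p).2 h₁
    have h₂' := (full_descentComparison_iff p).2 h₂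
    refine { essSurj := ⟨fun A => ?_⟩ }
    obtain ⟨D, d, q, hq⟩ := h₃ (descentDatumOfAlgebra p A)
    exact ⟨Over.mk d, ⟨comparisonIso p A hq.isPullback hq.w⟩⟩

end Comparison

lemma isAlmostDescent_iff {p : x ⟶ y} :
    IsAlmostDescent p ↔ HasPullbacksAlong p ∧ MapsDetected p :=
  ⟨fun ⟨h, h'⟩ => ⟨h, (faithful_descentComparison_iff p).1 h'⟩,
    fun ⟨h, h'⟩ => ⟨h, (faithful_descentComparison_iff p).2 h'⟩⟩

lemma isDescent_iff {p : x ⟶ y} :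
    IsDescent p ↔ HasPullbacksAlong p ∧ MapsDetected p ∧ MapsDescend p :=
  ⟨fun ⟨h, h₁, h₂⟩ => ⟨h, (faithful_descentComparison_iff p).1 h₂,
      (full_descentComparison_iff p).1 h₁⟩,
    fun ⟨h, h₁, h₂⟩ => by
      have := (faithful_descentComparison_iff p).2 h₁
      exact ⟨h, (full_descentComparison_iff p).2 h₂, this⟩⟩

lemma isEffectiveDescent_iff {p : x ⟶ y} :
    IsEffectiveDescent p ↔
      HasPullbacksAlong p ∧ MapsDetected p ∧ MapsDescend p ∧ DataDescend p :=
  ⟨fun ⟨h, h'⟩ => ⟨h, (isEquivalence_descentComparison_iff p).1 h'⟩,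
    fun ⟨h, h'⟩ => ⟨h, (isEquivalence_descentComparison_iff p).2 h'⟩⟩

end Elementary

/-! ### Descent in pseudo-equalizers -/

section Transport

variable {M : Type u₁} [Category.{v₁} M] {N : Type u₂} [Category.{v₂} N]

/-- A functor that preserves pullbacks transports the test for factorization through `q` in
`MapsDescend`, because kernel pairs are preserved. -/
lemma eq_of_map_eq [HasPullbacks M] (F : M ⥤ N) [PreservesLimitsOfShape WalkingCospan F]
    {P A Z : M} {q : P ⟶ A} {ψ : P ⟶ Z}
    (h : ∀ ⦃R : M⦄ (r₁ r₂ : R ⟶ P), r₁ ≫ q = r₂ ≫ q → r₁ ≫ ψ = r₂ ≫ ψ)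
    ⦃R : N⦄ (r₁ r₂ : R ⟶ F.obj P) (hr : r₁ ≫ F.map q = r₂ ≫ F.map q) :
    r₁ ≫ F.map ψ = r₂ ≫ F.map ψ := by
  obtain ⟨l, hl₁, hl₂⟩ := ((IsPullback.of_hasPullback q q).map F).exists_lift r₁ r₂ hr
  rw [← hl₁, ← hl₂, Category.assoc, Category.assoc, ← F.map_comp, ← F.map_comp,
    h _ _ pullback.condition]

/-- The image of a descent datum under a functor that preserves pullbacks. -/
def DescentDatum.map [HasPullbacks M] (F : M ⥤ N) [PreservesLimitsOfShape WalkingCospan F]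
    {x y c₀ : M} {p : x ⟶ y} {c : c₀ ⟶ x} (𝔡 : DescentDatum p c) :
    DescentDatum (F.map p) (F.map c) where
  R := F.obj 𝔡.R
  r₁ := F.map 𝔡.r₁
  r₂ := F.map 𝔡.r₂
  isPullback := by simpa using 𝔡.isPullback.map F
  refl := by
    obtain ⟨i, h₁, h₂⟩ := 𝔡.refl
    exact ⟨F.map i, by rw [← F.map_comp, h₁, F.map_id], by rw [← F.map_comp, h₂, F.map_id]⟩
  trans S s t h := by
    obtain ⟨w, h₁, h₂⟩ := 𝔡.trans (pullback.fst 𝔡.r₂ 𝔡.r₁) (pullback.snd 𝔡.r₂ 𝔡.r₁)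
      pullback.condition
    obtain ⟨l, hl₁, hl₂⟩ := ((IsPullback.of_hasPullback 𝔡.r₂ 𝔡.r₁).map F).exists_lift s t h
    refine ⟨l ≫ F.map w, ?_, ?_⟩
    · rw [Category.assoc, ← F.map_comp, h₁, F.map_comp, reassoc_of% hl₁]
    · rw [Category.assoc, ← F.map_comp, h₂, F.map_comp, reassoc_of% hl₂]

lemma DescentDatum.IsSolution.isKernelPair {x y c₀ D : M} {p : x ⟶ y} {c : c₀ ⟶ x}
    {𝔡 : DescentDatum p c} {d : D ⟶ y} {q : c₀ ⟶ D} (h : 𝔡.IsSolution d q) :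
    IsPullback 𝔡.r₁ 𝔡.r₂ q q := by
  refine (IsPullback.of_right ?_ h.w.symm h.isPullback.flip).flip
  rw [h.isPullback.w]
  exact 𝔡.isPullback.flip

end Transport

namespace PsEq

variable {M : Type u₁} [Category.{v₁} M] {N : Type u₂} [Category.{v₂} N] {F G : M ⥤ N}

variable (F G) in
/-- The functor that forgets the inserted isomorphism. -/
def forget : PsEq F G ⥤ M where
  obj X := X.obj
  map f := Hom.hom f

lemma hom_ext {X Y : PsEq F G} {f g : X ⟶ Y} (h : Hom.hom f = Hom.hom g) : f = g :=
  Hom.ext h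

variable [PreservesLimitsOfShape WalkingCospan G]

lemma isPullback_of_isPullback_hom {W X Y Z : PsEq F G} {fst : W ⟶ X} {snd : W ⟶ Y}
    {f : X ⟶ Z} {g : Y ⟶ Z}
    (h : IsPullback (Hom.hom fst) (Hom.hom snd) (Hom.hom f) (Hom.hom g)) :
    IsPullback fst snd f g := by
  refine IsPullback.mk' (hom_ext h.w) (fun S φ φ' h₁ h₂ => hom_ext ?_) (fun S a b hab => ?_)
  · exact h.hom_ext (congrArg Hom.hom h₁) (congrArg Hom.hom h₂)
  · obtain ⟨l, hl₁, hl₂⟩ := h.exists_lift (Hom.hom a) (Hom.hom b) (congrArg Hom.hom hab)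
    refine ⟨⟨l, ?_⟩, hom_ext hl₁, hom_ext hl₂⟩
    refine (h.map G).hom_ext ?_ ?_
    · rw [Category.assoc, Category.assoc, ← G.map_comp, hl₁, Hom.comm a, Hom.comm fst,
        ← F.map_comp_assoc, hl₁]
    · rw [Category.assoc, Category.assoc, ← G.map_comp, hl₂, Hom.comm b, Hom.comm snd,
        ← F.map_comp_assoc, hl₂]

/-- The base change of the image of `p` under `G`, regarded as a base change of the image of `p`
under `F` along the inserted isomorphisms. -/
lemma isPullback_map_iso {P A : M} {X Y : PsEq F G} {p : X ⟶ Y} {q : P ⟶ A} {c : P ⟶ X.obj}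
    {d : A ⟶ Y.obj} (h : IsPullback q c d (Hom.hom p)) :
    IsPullback (G.map q) (G.map c ≫ X.iso.inv) (G.map d ≫ Y.iso.inv) (F.map (Hom.hom p)) := by
  refine (h.map G).of_iso (Iso.refl _) (Iso.refl _) X.iso.symm Y.iso.symm ?_ ?_ ?_ ?_
  · simp
  · simp
  · simp
  · rw [Iso.symm_hom, Iso.symm_hom, Iso.comp_inv_eq, Category.assoc, ← Hom.comm p,
      Iso.inv_hom_id_assoc]

variable [PreservesLimitsOfShape WalkingCospan F] [HasPullbacks M]

lemma exists_isPullback_hom {X Y Z : PsEq F G} (f : X ⟶ Z) (g : Y ⟶ Z) :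
    ∃ (W : PsEq F G) (fst : W ⟶ X) (snd : W ⟶ Y),
      IsPullback (Hom.hom fst) (Hom.hom snd) (Hom.hom f) (Hom.hom g) := by
  have h := IsPullback.of_hasPullback (Hom.hom f) (Hom.hom g)
  have hF : IsPullback (F.map (pullback.fst (Hom.hom f) (Hom.hom g)) ≫ X.iso.hom)
      (F.map (pullback.snd (Hom.hom f) (Hom.hom g)) ≫ Y.iso.hom)
      (G.map (Hom.hom f)) (G.map (Hom.hom g)) := by
    refine (h.map F).of_iso (Iso.refl _) X.iso Y.iso Z.iso ?_ ?_ ?_ ?_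
    · simp
    · simp
    · exact (Hom.comm f).symm
    · exact (Hom.comm g).symm
  let e := hF.isoIsPullback _ _ (h.map G)
  exact ⟨⟨_, e⟩, ⟨_, IsPullback.isoIsPullback_hom_fst _ _ _ _⟩,
    ⟨_, IsPullback.isoIsPullback_hom_snd _ _ _ _⟩, h⟩

instance hasPullbacks : HasPullbacks (PsEq F G) := by
  have (X Y Z : PsEq F G) (f : X ⟶ Z) (g : Y ⟶ Z) : HasLimit (cospan f g) := by
    obtain ⟨W, fst, snd, h⟩ := exists_isPullback_hom f g
    exact (isPullback_of_isPullback_hom h).hasPullback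
  exact hasPullbacks_of_hasLimit_cospan _

instance preservesPullbacks_forget : PreservesLimitsOfShape WalkingCospan (forget F G) :=
  preservesLimitsOfShape_walkingCospan_of_forall_isPullback fun X Y Z f g _ => by
    obtain ⟨W, fst, snd, h⟩ := exists_isPullback_hom f g
    exact ⟨W, fst, snd, isPullback_of_isPullback_hom h, h⟩

variable {X Y : PsEq F G} {p : X ⟶ Y}

lemma mapsDetected (h : MapsDetected (Hom.hom p)) : MapsDetected p :=
  fun _ _ _ _ _ _ hq _ _ _ hf hg hfg => hom_ext <|
    h (hq.map (forget F G)) (congrArg Hom.hom hf) (congrArg Hom.hom hg) (congrArg Hom.hom hfg)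

lemma mapsDescend (h : MapsDescend (Hom.hom p)) (hF : MapsDetected (F.map (Hom.hom p))) :
    MapsDescend p := by
  intro A P Z q π a hq z ψ hψ hr
  have hq' : IsPullback (Hom.hom q) (Hom.hom π) (Hom.hom a) (Hom.hom p) := hq.map (forget F G)
  obtain ⟨f, hf₁, hf₂⟩ := h hq' (Hom.hom ψ) (congrArg Hom.hom hψ)
    (eq_of_map_eq (forget F G) hr)
  refine ⟨⟨f, ?_⟩, hom_ext hf₁, hom_ext hf₂⟩
  refine hF (hq'.map F) (z := G.map (Hom.hom z) ≫ Y.iso.inv) ?_ ?_ ?_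
  · rw [Category.assoc, ← G.map_comp_assoc, hf₂, reassoc_of% (Hom.comm a), Iso.hom_inv_id,
      Category.comp_id]
  · rw [Category.assoc, reassoc_of% (Hom.comm z), Iso.hom_inv_id, Category.comp_id,
      ← F.map_comp, hf₂]
  · rw [← F.map_comp_assoc, hf₁, ← Hom.comm ψ, ← reassoc_of% (Hom.comm q), ← G.map_comp, hf₁]

/-- A descent datum in the pseudo-equalizer is solved in `M`; the isomorphism inserted at the
solution is obtained by descent, in `N` and along the image of `p`, from the one inserted at the
given object. -/
lemma dataDescend (h : DataDescend (Hom.hom p)) (hF₁ : MapsDetected (F.map (Hom.hom p)))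
    (hF₂ : MapsDescend (F.map (Hom.hom p))) : DataDescend p := by
  intro c₀ c 𝔡
  obtain ⟨D, d, q, hqp, hker⟩ : ∃ (D : M) (d : D ⟶ Y.obj) (q : c₀.obj ⟶ D),
      IsPullback q (Hom.hom c) d (Hom.hom p) ∧
        IsPullback (Hom.hom 𝔡.r₁) (Hom.hom 𝔡.r₂) q q := by
    obtain ⟨D, d, q, hq⟩ := h (𝔡.map (forget F G))
    exact ⟨D, d, q, hq.isPullback, hq.isKernelPair⟩
  have hp := reassoc_of% (Hom.comm p)
  have hcp : c₀.iso.hom ≫ G.map (Hom.hom c) ≫ G.map (Hom.hom p) ≫ Y.iso.inv =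
      F.map (Hom.hom c) ≫ F.map (Hom.hom p) := by
    rw [reassoc_of% (Hom.comm c), hp, Iso.hom_inv_id, Category.comp_id]
  have hover : (c₀.iso.hom ≫ G.map q) ≫ G.map d ≫ Y.iso.inv = F.map q ≫ F.map d := by
    rw [Category.assoc, ← G.map_comp_assoc, hqp.w, G.map_comp, Category.assoc, hcp,
      ← F.map_comp, ← F.map_comp, hqp.w]
  obtain ⟨k, hk₁, hk₂⟩ := hF₂ (hqp.map F) (c₀.iso.hom ≫ G.map q) hover (by
    intro R s t hst
    obtain ⟨l, rfl, rfl⟩ := (hker.map F).exists_lift s t hst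
    rw [Category.assoc, Category.assoc, ← reassoc_of% (Hom.comm 𝔡.r₁),
      ← reassoc_of% (Hom.comm 𝔡.r₂), ← G.map_comp, ← G.map_comp, hker.w])
  have hqG := isPullback_map_iso hqp
  obtain ⟨k', hk'₁, hk'₂⟩ := hF₂ hqG (c₀.iso.inv ≫ F.map q) (z := F.map d)
    (by rw [Category.assoc, ← hover, Category.assoc, Iso.inv_hom_id_assoc]) (by
    intro R s t hst
    obtain ⟨l, rfl, rfl⟩ := (hker.map G).exists_lift s t hst
    have h₁ : G.map (Hom.hom 𝔡.r₁) ≫ c₀.iso.inv = 𝔡.R.iso.inv ≫ F.map (Hom.hom 𝔡.r₁) := by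
      rw [Iso.comp_inv_eq, Category.assoc, ← Hom.comm, Iso.inv_hom_id_assoc]
    have h₂ : G.map (Hom.hom 𝔡.r₂) ≫ c₀.iso.inv = 𝔡.R.iso.inv ≫ F.map (Hom.hom 𝔡.r₂) := by
      rw [Iso.comp_inv_eq, Category.assoc, ← Hom.comm, Iso.inv_hom_id_assoc]
    rw [Category.assoc, Category.assoc, reassoc_of% h₁, reassoc_of% h₂,
      ← F.map_comp, ← F.map_comp, hker.w])
  have hkk' : k ≫ k' = 𝟙 _ := hF₁ (hqp.map F) (z := F.map d)
    (by rw [Category.assoc, hk'₂, hk₂]) (Category.id_comp _) (by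
      rw [reassoc_of% hk₁, hk'₁, Iso.hom_inv_id_assoc, Category.comp_id])
  have hk'k : k' ≫ k = 𝟙 _ := hF₁ hqG (z := G.map d ≫ Y.iso.inv)
    (by rw [Category.assoc, hk₂, hk'₂]) (Category.id_comp _) (by
      rw [reassoc_of% hk'₁, hk₁, Iso.inv_hom_id_assoc, Category.comp_id])
  rw [← Category.assoc, Iso.comp_inv_eq] at hk₂
  exact ⟨⟨D, ⟨k, k', hkk', hk'k⟩⟩, ⟨d, hk₂⟩, ⟨q, hk₁.symm⟩,
    isPullback_of_isPullback_hom hqp, hom_ext hker.w⟩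

/-- Let `F` and `G` preserve pullbacks. A morphism of the pseudo-equalizer is effective for
descent if its underlying morphism is so and its image under `F` is a descent morphism. -/
theorem isEffectiveDescent (h : IsEffectiveDescent (Hom.hom p))
    (hF₁ : MapsDetected (F.map (Hom.hom p))) (hF₂ : MapsDescend (F.map (Hom.hom p))) :
    IsEffectiveDescent p := by
  obtain ⟨-, h₁, h₂, h₃⟩ := isEffectiveDescent_iff.1 h
  exact isEffectiveDescent_iff.2
    ⟨inferInstance, mapsDetected h₁, mapsDescend h₂ hF₁, dataDescend h₃ hF₁ hF₂⟩

end PsEq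

/-! ### Products of categories -/

section Prod

variable {M : Type u₁} [Category.{v₁} M] {N : Type u₂} [Category.{v₂} N]

lemma isPullback_prod_iff {W X Y Z : M × N} {f : W ⟶ X} {g : W ⟶ Y} {h : X ⟶ Z} {k : Y ⟶ Z} :
    IsPullback f g h k ↔ IsPullback f.1 g.1 h.1 k.1 ∧ IsPullback f.2 g.2 h.2 k.2 := by
  constructor
  · intro H
    have w₁ : f.1 ≫ h.1 = g.1 ≫ k.1 := congrArg (fun φ : W ⟶ Z => φ.1) H.w
    have w₂ : f.2 ≫ h.2 = g.2 ≫ k.2 := congrArg (fun φ : W ⟶ Z => φ.2) H.w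
    constructor
    · refine IsPullback.mk' w₁ (fun S φ φ' h₁ h₂ => ?_) (fun S a b hab => ?_)
      · have := H.hom_ext (W := (S, W.2)) (k := (φ, 𝟙 _)) (l := (φ', 𝟙 _)) (Prod.ext h₁ rfl)
          (Prod.ext h₂ rfl)
        exact congrArg Prod.fst this
      · obtain ⟨l, h₁, h₂⟩ := H.exists_lift (W := (S, W.2)) (a, f.2) (b, g.2) (Prod.ext hab w₂)
        exact ⟨l.1, congrArg Prod.fst h₁, congrArg Prod.fst h₂⟩
    · refine IsPullback.mk' w₂ (fun S φ φ' h₁ h₂ => ?_) (fun S a b hab => ?_)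
      · have := H.hom_ext (W := (W.1, S)) (k := (𝟙 _, φ)) (l := (𝟙 _, φ')) (Prod.ext rfl h₁)
          (Prod.ext rfl h₂)
        exact congrArg Prod.snd this
      · obtain ⟨l, h₁, h₂⟩ := H.exists_lift (W := (W.1, S)) (f.1, a) (g.1, b) (Prod.ext w₁ hab)
        exact ⟨l.2, congrArg Prod.snd h₁, congrArg Prod.snd h₂⟩
  · rintro ⟨H₁, H₂⟩
    refine IsPullback.mk' (Prod.ext H₁.w H₂.w) (fun S φ φ' h₁ h₂ => ?_) (fun S a b hab => ?_)
    · exact Prod.ext (H₁.hom_ext (congrArg Prod.fst h₁) (congrArg Prod.fst h₂))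
        (H₂.hom_ext (congrArg Prod.snd h₁) (congrArg Prod.snd h₂))
    · obtain ⟨l₁, h₁, h₁'⟩ := H₁.exists_lift a.1 b.1 (congrArg Prod.fst hab)
      obtain ⟨l₂, h₂, h₂'⟩ := H₂.exists_lift a.2 b.2 (congrArg Prod.snd hab)
      exact ⟨(l₁, l₂), Prod.ext h₁ h₂, Prod.ext h₁' h₂'⟩

lemma mapsDetected_prod {x y : M × N} {p : x ⟶ y} (h₁ : MapsDetected p.1)
    (h₂ : MapsDetected p.2) : MapsDetected p := by
  intro A P Z q π a hq z f g hf hg hfg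
  obtain ⟨hq₁, hq₂⟩ := isPullback_prod_iff.1 hq
  exact Prod.ext
    (h₁ hq₁ (congrArg Prod.fst hf) (congrArg Prod.fst hg) (congrArg Prod.fst hfg))
    (h₂ hq₂ (congrArg Prod.snd hf) (congrArg Prod.snd hg) (congrArg Prod.snd hfg))

lemma mapsDescend_prod {x y : M × N} {p : x ⟶ y} (h₁ : MapsDescend p.1)
    (h₂ : MapsDescend p.2) : MapsDescend p := by
  intro A P Z q π a hq z ψ hψ hr
  obtain ⟨hq₁, hq₂⟩ := isPullback_prod_iff.1 hq
  obtain ⟨f₁, hf₁, hf₁'⟩ := h₁ hq₁ (z := z.1) ψ.1 (congrArg Prod.fst hψ) fun R r₁ r₂ h =>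
    congrArg Prod.fst (hr (R := (R, P.2)) (r₁, 𝟙 _) (r₂, 𝟙 _) (Prod.ext h rfl))
  obtain ⟨f₂, hf₂, hf₂'⟩ := h₂ hq₂ (z := z.2) ψ.2 (congrArg Prod.snd hψ) fun R r₁ r₂ h =>
    congrArg Prod.snd (hr (R := (P.1, R)) (𝟙 _, r₁) (𝟙 _, r₂) (Prod.ext rfl h))
  exact ⟨(f₁, f₂), Prod.ext hf₁ hf₂, Prod.ext hf₁' hf₂'⟩

instance preservesPullbacks_prod' {K : Type*} [Category* K] (F : K ⥤ M) (G : K ⥤ N)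
    [PreservesLimitsOfShape WalkingCospan F] [PreservesLimitsOfShape WalkingCospan G] :
    PreservesLimitsOfShape WalkingCospan (F.prod' G) :=
  preservesLimitsOfShape_walkingCospan_of_forall_isPullback fun _ _ _ f g _ =>
    have h := IsPullback.of_hasPullback f g
    ⟨_, _, _, h, isPullback_prod_iff.2 ⟨h.map F, h.map G⟩⟩

end Prod

/-! ### Relative descent of morphisms -/

section Relative

variable {B : Type u} [Category.{v} B] [HasPullbacks B] {x y : B} {p : x ⟶ y}

/-- Morphisms that lie over a morphism `w` out of `y` are detected as well. -/
lemma MapsDetected.eq_of_comp_eq (hp : MapsDetected p) {A P Z W : B} {q : P ⟶ A} {π : P ⟶ x}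
    {a : A ⟶ y} (hq : IsPullback q π a p) {w : y ⟶ W} {z : Z ⟶ W} {f g : A ⟶ Z}
    (hf : f ≫ z = a ≫ w) (hg : g ≫ z = a ≫ w) (h : q ≫ f = q ≫ g) : f = g := by
  have hW := IsPullback.of_hasPullback z w
  obtain ⟨f', hf₁, hf₂⟩ := hW.exists_lift f a hf
  obtain ⟨g', hg₁, hg₂⟩ := hW.exists_lift g a hg
  rw [← hf₁, ← hg₁, hp hq hf₂ hg₂ (hW.hom_ext ?_ ?_)]
  · rw [Category.assoc, Category.assoc, hf₁, hg₁, h]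
  · rw [Category.assoc, Category.assoc, hf₂, hg₂]

/-- Morphisms that lie over a morphism `w` out of `y` descend as well. -/
lemma MapsDescend.exists_comp_eq (hp : MapsDescend p) {A P Z W : B} {q : P ⟶ A} {π : P ⟶ x}
    {a : A ⟶ y} (hq : IsPullback q π a p) {w : y ⟶ W} {z : Z ⟶ W} (ψ : P ⟶ Z)
    (hψ : ψ ≫ z = q ≫ a ≫ w)
    (h : ∀ ⦃R : B⦄ (r₁ r₂ : R ⟶ P), r₁ ≫ q = r₂ ≫ q → r₁ ≫ ψ = r₂ ≫ ψ) :
    ∃ f : A ⟶ Z, q ≫ f = ψ ∧ f ≫ z = a ≫ w := by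
  have hW := IsPullback.of_hasPullback z w
  obtain ⟨ψ', hψ₁, hψ₂⟩ := hW.exists_lift ψ (q ≫ a) (by rw [hψ, Category.assoc])
  obtain ⟨f, hf₁, hf₂⟩ := hp hq ψ' hψ₂ (fun R r₁ r₂ hr => hW.hom_ext
    (by rw [Category.assoc, Category.assoc, hψ₁, h _ _ hr])
    (by rw [Category.assoc, Category.assoc, hψ₂, reassoc_of% hr]))
  refine ⟨f ≫ pullback.fst z w, by rw [reassoc_of% hf₁, hψ₁], ?_⟩
  rw [Category.assoc, hW.w, reassoc_of% hf₂]

end Relative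

/-! ### Functor categories -/

section FunctorCategory

variable {J : Type u₁} [Category.{v₁} J] {B : Type u} [Category.{v} B] [HasPullbacks B]

section Maps

variable {X Y : J ⥤ B} {p : X ⟶ Y}

lemma mapsDetected_of_app (hp : ∀ j, MapsDetected (p.app j)) : MapsDetected p := by
  intro A P Z q π a hq z f g hf hg hfg
  ext j
  exact hp j (hq.app j) (NatTrans.congr_app hf j) (NatTrans.congr_app hg j)
    (NatTrans.congr_app hfg j)

variable {A P Z : J ⥤ B} {q : P ⟶ A} {π : P ⟶ X} {a : A ⟶ Y} {z : Z ⟶ Y} {ψ : P ⟶ Z}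

lemma app_naturality (hq : IsPullback q π a p) {i j : J} (hp : MapsDetected (p.app i))
    {f : A.obj i ⟶ Z.obj i} {f' : A.obj j ⟶ Z.obj j}
    (hf : q.app i ≫ f = ψ.app i) (hfz : f ≫ z.app i = a.app i)
    (hf' : q.app j ≫ f' = ψ.app j) (hfz' : f' ≫ z.app j = a.app j) (g : i ⟶ j) :
    A.map g ≫ f' = f ≫ Z.map g := by
  refine hp.eq_of_comp_eq (hq.app i) (w := Y.map g) (z := z.app j) ?_ ?_ ?_
  · rw [Category.assoc, hfz', a.naturality]
  · rw [Category.assoc, z.naturality, reassoc_of% hfz]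
  · rw [← q.naturality_assoc, hf', reassoc_of% hf, ψ.naturality]

/-- Morphisms obtained objectwise by descent form a natural transformation. -/
lemma exists_natTrans (hq : IsPullback q π a p) (hp : ∀ j, MapsDetected (p.app j))
    (h : ∀ j, ∃ f : A.obj j ⟶ Z.obj j, q.app j ≫ f = ψ.app j ∧ f ≫ z.app j = a.app j) :
    ∃ f : A ⟶ Z, q ≫ f = ψ ∧ f ≫ z = a := by
  choose f hf hfz using h
  exact ⟨⟨f, fun i j g => app_naturality hq (hp i) (hf i) (hfz i) (hf j) (hfz j) g⟩,
    by ext j; exact hf j, by ext j; exact hfz j⟩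

lemma exists_app (hq : IsPullback q π a p) (hψ : ψ ≫ z = q ≫ a)
    (h : ∀ ⦃R : J ⥤ B⦄ (r₁ r₂ : R ⟶ P), r₁ ≫ q = r₂ ≫ q → r₁ ≫ ψ = r₂ ≫ ψ) {j : J}
    (hp : MapsDescend (p.app j)) :
    ∃ f : A.obj j ⟶ Z.obj j, q.app j ≫ f = ψ.app j ∧ f ≫ z.app j = a.app j :=
  hp (hq.app j) (ψ.app j) (NatTrans.congr_app hψ j) (eq_of_map_eq ((evaluation J B).obj j) h)

lemma mapsDescend_of_app (hp : ∀ j, MapsDetected (p.app j)) (hp' : ∀ j, MapsDescend (p.app j)) :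
    MapsDescend p :=
  fun _ _ _ _ _ _ hq _ _ hψ h => exists_natTrans hq hp fun j => exists_app hq hψ h (hp' j)

omit [HasPullbacks B] in
/-- An objectwise factorization at the vertex of a square that `Z` and `Y` send to pullbacks is
obtained from factorizations at the other three objects. -/
lemma exists_app_of_isPullback {v i j k : J} {f : v ⟶ i} {g : v ⟶ j}
    {f' : i ⟶ k} {g' : j ⟶ k} (hfg : f ≫ f' = g ≫ g')
    (hZ : IsPullback (Z.map f) (Z.map g) (Z.map f') (Z.map g'))
    (hY : IsPullback (Y.map f) (Y.map g) (Y.map f') (Y.map g'))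
    {s : A.obj i ⟶ Z.obj i} {t : A.obj j ⟶ Z.obj j} {r : A.obj k ⟶ Z.obj k}
    (hs : q.app i ≫ s = ψ.app i) (hsz : s ≫ z.app i = a.app i)
    (ht : q.app j ≫ t = ψ.app j) (htz : t ≫ z.app j = a.app j)
    (hsr : A.map f' ≫ r = s ≫ Z.map f') (htr : A.map g' ≫ r = t ≫ Z.map g') :
    ∃ l : A.obj v ⟶ Z.obj v, q.app v ≫ l = ψ.app v ∧ l ≫ z.app v = a.app v := by
  obtain ⟨l, hl₁, hl₂⟩ := hZ.exists_lift (A.map f ≫ s) (A.map g ≫ t) (by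
    rw [Category.assoc, Category.assoc, ← hsr, ← htr, ← A.map_comp_assoc, hfg,
      A.map_comp_assoc])
  refine ⟨l, hZ.hom_ext ?_ ?_, hY.hom_ext ?_ ?_⟩
  · rw [Category.assoc, hl₁, ← q.naturality_assoc, hs, ψ.naturality]
  · rw [Category.assoc, hl₂, ← q.naturality_assoc, ht, ψ.naturality]
  · rw [Category.assoc, ← z.naturality, reassoc_of% hl₁, hsz, a.naturality]
  · rw [Category.assoc, ← z.naturality, reassoc_of% hl₂, htz, a.naturality]

end Maps

/-- The functors that send a given commutative square to a pullback are closed under pullbacks. -/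
lemma isPullback_map_of_isPullback {W X Y Z : J ⥤ B} {fst : W ⟶ X} {snd : W ⟶ Y} {f : X ⟶ Z}
    {g : Y ⟶ Z} (h : IsPullback fst snd f g) {v i j k : J} {α : v ⟶ i} {β : v ⟶ j}
    {α' : i ⟶ k} {β' : j ⟶ k} (hαβ : α ≫ α' = β ≫ β')
    (hX : IsPullback (X.map α) (X.map β) (X.map α') (X.map β'))
    (hY : IsPullback (Y.map α) (Y.map β) (Y.map α') (Y.map β'))
    (hZ : IsPullback (Z.map α) (Z.map β) (Z.map α') (Z.map β')) :
    IsPullback (W.map α) (W.map β) (W.map α') (W.map β') := by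
  refine IsPullback.mk' (by rw [← W.map_comp, hαβ, W.map_comp]) (fun T φ φ' h₁ h₂ => ?_)
    (fun T s t hst => ?_)
  · refine (h.app v).hom_ext (hX.hom_ext ?_ ?_) (hY.hom_ext ?_ ?_)
    · simp only [Category.assoc, ← fst.naturality, reassoc_of% h₁]
    · simp only [Category.assoc, ← fst.naturality, reassoc_of% h₂]
    · simp only [Category.assoc, ← snd.naturality, reassoc_of% h₁]
    · simp only [Category.assoc, ← snd.naturality, reassoc_of% h₂]
  · obtain ⟨l, hl₁, hl₂⟩ := hX.exists_lift (s ≫ fst.app i) (t ≫ fst.app j) (by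
      rw [Category.assoc, Category.assoc, ← fst.naturality, ← fst.naturality, reassoc_of% hst])
    obtain ⟨m, hm₁, hm₂⟩ := hY.exists_lift (s ≫ snd.app i) (t ≫ snd.app j) (by
      rw [Category.assoc, Category.assoc, ← snd.naturality, ← snd.naturality, reassoc_of% hst])
    obtain ⟨n, hn₁, hn₂⟩ := (h.app v).exists_lift l m (hZ.hom_ext
      (by rw [Category.assoc, Category.assoc, ← f.naturality, ← g.naturality, reassoc_of% hl₁,
        reassoc_of% hm₁, (h.app i).w])
      (by rw [Category.assoc, Category.assoc, ← f.naturality, ← g.naturality, reassoc_of% hl₂,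
        reassoc_of% hm₂, (h.app j).w]))
    refine ⟨n, (h.app i).hom_ext ?_ ?_, (h.app j).hom_ext ?_ ?_⟩
    · rw [Category.assoc, fst.naturality, reassoc_of% hn₁, hl₁]
    · rw [Category.assoc, snd.naturality, reassoc_of% hn₂, hm₁]
    · rw [Category.assoc, fst.naturality, reassoc_of% hn₁, hl₂]
    · rw [Category.assoc, snd.naturality, reassoc_of% hn₂, hm₂]

section Data

variable {X Y c₀ : J ⥤ B} {p : X ⟶ Y} {c : c₀ ⟶ X} (𝔡 : DescentDatum p c)

/-- A solution of the descent problem posed by `𝔡` at the object `j`. -/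
structure LocalSolution (j : J) where
  /-- the descended object -/
  D : B
  /-- its structure morphism -/
  d : D ⟶ Y.obj j
  /-- the morphism that exhibits the given object as a base change -/
  q : c₀.obj j ⟶ D
  isPullback : IsPullback q (c.app j) d (p.app j)
  w : 𝔡.r₁.app j ≫ q = 𝔡.r₂.app j ≫ q

variable {𝔡}

lemma DataDescend.nonempty_localSolution {j : J} (h : DataDescend (p.app j)) :
    Nonempty (LocalSolution 𝔡 j) :=
  have ⟨D, d, q, hq⟩ := h (𝔡.map ((evaluation J B).obj j))
  ⟨⟨D, d, q, hq.isPullback, hq.w⟩⟩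

lemma LocalSolution.isKernelPair {j : J} (S : LocalSolution 𝔡 j) :
    IsPullback (𝔡.r₁.app j) (𝔡.r₂.app j) S.q S.q :=
  DescentDatum.IsSolution.isKernelPair (𝔡 := 𝔡.map ((evaluation J B).obj j))
    ⟨S.isPullback, S.w⟩

/-- `φ` is the morphism between solutions induced by `g`. -/
structure IsDescended {i j : J} (S : LocalSolution 𝔡 i) (S' : LocalSolution 𝔡 j) (g : i ⟶ j)
    (φ : S.D ⟶ S'.D) : Prop where
  q_comp : S.q ≫ φ = c₀.map g ≫ S'.q
  comp_d : φ ≫ S'.d = S.d ≫ Y.map g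

namespace IsDescended

omit [HasPullbacks B] in
lemma id {i : J} (S : LocalSolution 𝔡 i) : IsDescended S S (𝟙 i) (𝟙 S.D) :=
  ⟨by simp, by simp⟩

omit [HasPullbacks B] in
lemma comp {i j k : J} {S : LocalSolution 𝔡 i} {S' : LocalSolution 𝔡 j} {S'' : LocalSolution 𝔡 k}
    {g : i ⟶ j} {g' : j ⟶ k} {φ : S.D ⟶ S'.D} {φ' : S'.D ⟶ S''.D} (h : IsDescended S S' g φ)
    (h' : IsDescended S' S'' g' φ') : IsDescended S S'' (g ≫ g') (φ ≫ φ') :=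
  ⟨by rw [reassoc_of% h.q_comp, h'.q_comp, c₀.map_comp_assoc],
    by rw [Category.assoc, h'.comp_d, reassoc_of% h.comp_d, Y.map_comp]⟩

lemma unique {i j : J} (hp : MapsDetected (p.app i)) {S : LocalSolution 𝔡 i}
    {S' : LocalSolution 𝔡 j} {g : i ⟶ j} {φ φ' : S.D ⟶ S'.D} (h : IsDescended S S' g φ)
    (h' : IsDescended S S' g φ') : φ = φ' :=
  hp.eq_of_comp_eq S.isPullback h.comp_d h'.comp_d (h.q_comp.trans h'.q_comp.symm)

lemma exists_of_mapsDescend {i j : J} (hp : MapsDescend (p.app i)) (S : LocalSolution 𝔡 i)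
    (S' : LocalSolution 𝔡 j) (g : i ⟶ j) : ∃ φ, IsDescended S S' g φ := by
  obtain ⟨φ, h₁, h₂⟩ := hp.exists_comp_eq S.isPullback (w := Y.map g) (z := S'.d)
    (c₀.map g ≫ S'.q) (by
      rw [Category.assoc, S'.isPullback.w, c.naturality_assoc, p.naturality,
        reassoc_of% S.isPullback.w])
    (fun R s t hst => by
      obtain ⟨l, rfl, rfl⟩ := S.isKernelPair.exists_lift s t hst
      rw [Category.assoc, Category.assoc, ← 𝔡.r₁.naturality_assoc, ← 𝔡.r₂.naturality_assoc,
        S'.w])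
  exact ⟨φ, h₁, h₂⟩

/-- A morphism into the vertex of a pullback square of solutions descends if its composites with
the two projections do. -/
lemma exists_of_isPullback {u v i j k : J} (hp : MapsDetected (p.app u))
    {U : LocalSolution 𝔡 u} {V : LocalSolution 𝔡 v} {S : LocalSolution 𝔡 i}
    {T : LocalSolution 𝔡 j} {R : LocalSolution 𝔡 k}
    {α : v ⟶ i} {β : v ⟶ j} {α' : i ⟶ k} {β' : j ⟶ k} (hαβ : α ≫ α' = β ≫ β')
    {a : V.D ⟶ S.D} {b : V.D ⟶ T.D} {a' : S.D ⟶ R.D} {b' : T.D ⟶ R.D}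
    (ha : IsDescended V S α a) (hb : IsDescended V T β b)
    (ha' : IsDescended S R α' a') (hb' : IsDescended T R β' b')
    (h : IsPullback a b a' b') (g : u ⟶ v)
    (h₁ : ∃ φ, IsDescended U S (g ≫ α) φ) (h₂ : ∃ φ, IsDescended U T (g ≫ β) φ) :
    ∃ φ, IsDescended U V g φ := by
  obtain ⟨s, hs⟩ := h₁
  obtain ⟨t, ht⟩ := h₂
  have hst : s ≫ a' = t ≫ b' := by
    refine (hs.comp ha').unique hp ?_
    rw [Category.assoc, hαβ, ← Category.assoc]
    exact ht.comp hb'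
  obtain ⟨l, hl₁, hl₂⟩ := h.exists_lift s t hst
  have hq : U.q ≫ l = c₀.map g ≫ V.q := by
    refine h.hom_ext ?_ ?_
    · rw [Category.assoc, hl₁, hs.q_comp, Category.assoc, ha.q_comp, c₀.map_comp_assoc]
    · rw [Category.assoc, hl₂, ht.q_comp, Category.assoc, hb.q_comp, c₀.map_comp_assoc]
  refine ⟨l, hq, ?_⟩
  refine hp.eq_of_comp_eq U.isPullback (w := Y.map (g ≫ α)) (z := Y.map α) ?_ ?_ ?_
  · rw [Category.assoc, ← ha.comp_d, reassoc_of% hl₁, hs.comp_d]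
  · rw [Category.assoc, Y.map_comp]
  · rw [reassoc_of% hq, V.isPullback.w, reassoc_of% U.isPullback.w, c.naturality_assoc,
      p.naturality]

end IsDescended

/-- At the vertex of a square that is sent to pullbacks by the three given functors, the pullback
of solutions is a solution. -/
lemma exists_localSolution_of_isPullback {v i j k : J} {α : v ⟶ i} {β : v ⟶ j} {α' : i ⟶ k}
    {β' : j ⟶ k} (hαβ : α ≫ α' = β ≫ β')
    (hc : IsPullback (c₀.map α) (c₀.map β) (c₀.map α') (c₀.map β'))
    (hX : IsPullback (X.map α) (X.map β) (X.map α') (X.map β'))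
    (hY : IsPullback (Y.map α) (Y.map β) (Y.map α') (Y.map β'))
    {S : LocalSolution 𝔡 i} {T : LocalSolution 𝔡 j} {R : LocalSolution 𝔡 k}
    {a' : S.D ⟶ R.D} {b' : T.D ⟶ R.D} (ha' : IsDescended S R α' a')
    (hb' : IsDescended T R β' b') :
    ∃ (V : LocalSolution 𝔡 v) (a : V.D ⟶ S.D) (b : V.D ⟶ T.D), IsDescended V S α a ∧
      IsDescended V T β b ∧ IsPullback a b a' b' := by
  have hD := IsPullback.of_hasPullback a' b'
  generalize pullback.fst a' b' = a, pullback.snd a' b' = b at hD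
  obtain ⟨d, hd₁, hd₂⟩ := hY.exists_lift (a ≫ S.d) (b ≫ T.d) (by
    rw [Category.assoc, Category.assoc, ← ha'.comp_d, ← hb'.comp_d, reassoc_of% hD.w])
  obtain ⟨q, hq₁, hq₂⟩ := hD.exists_lift (c₀.map α ≫ S.q) (c₀.map β ≫ T.q) (by
    rw [Category.assoc, Category.assoc, ha'.q_comp, hb'.q_comp, ← c₀.map_comp_assoc, hαβ,
      c₀.map_comp_assoc])
  have hw : q ≫ d = c.app v ≫ p.app v := by
    refine hY.hom_ext ?_ ?_
    · rw [Category.assoc, hd₁, reassoc_of% hq₁, S.isPullback.w, Category.assoc, ← p.naturality,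
        c.naturality_assoc]
    · rw [Category.assoc, hd₂, reassoc_of% hq₂, T.isPullback.w, Category.assoc, ← p.naturality,
        c.naturality_assoc]
  have h : IsPullback q (c.app v) d (p.app v) := by
    refine IsPullback.mk' hw (fun W φ φ' h₁ h₂ => hc.hom_ext ?_ ?_) (fun W s t hst => ?_)
    · refine S.isPullback.hom_ext ?_ ?_
      · rw [Category.assoc, Category.assoc, ← hq₁, reassoc_of% h₁]
      · rw [Category.assoc, Category.assoc, c.naturality, reassoc_of% h₂]
    · refine T.isPullback.hom_ext ?_ ?_
      · rw [Category.assoc, Category.assoc, ← hq₂, reassoc_of% h₁]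
      · rw [Category.assoc, Category.assoc, c.naturality, reassoc_of% h₂]
    · obtain ⟨l, hl₁, hl₂⟩ := S.isPullback.exists_lift (s ≫ a) (t ≫ X.map α) (by
        rw [Category.assoc, Category.assoc, ← hd₁, p.naturality, reassoc_of% hst])
      obtain ⟨m, hm₁, hm₂⟩ := T.isPullback.exists_lift (s ≫ b) (t ≫ X.map β) (by
        rw [Category.assoc, Category.assoc, ← hd₂, p.naturality, reassoc_of% hst])
      obtain ⟨n, hn₁, hn₂⟩ := hc.exists_lift l m (R.isPullback.hom_ext
        (by rw [Category.assoc, Category.assoc, ← ha'.q_comp, ← hb'.q_comp, reassoc_of% hl₁,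
          reassoc_of% hm₁, hD.w])
        (by rw [Category.assoc, Category.assoc, c.naturality, c.naturality, reassoc_of% hl₂,
          reassoc_of% hm₂, hX.w]))
      refine ⟨n, hD.hom_ext ?_ ?_, hX.hom_ext ?_ ?_⟩
      · rw [Category.assoc, hq₁, reassoc_of% hn₁, hl₁]
      · rw [Category.assoc, hq₂, reassoc_of% hn₂, hm₁]
      · rw [Category.assoc, ← c.naturality, reassoc_of% hn₁, hl₂]
      · rw [Category.assoc, ← c.naturality, reassoc_of% hn₂, hm₂]
  refine ⟨⟨_, d, q, h, hD.hom_ext ?_ ?_⟩, a, b, ⟨hq₁, hd₁.symm⟩, ⟨hq₂, hd₂.symm⟩, hD⟩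
  · rw [Category.assoc, Category.assoc, hq₁, ← 𝔡.r₁.naturality_assoc, ← 𝔡.r₂.naturality_assoc,
      S.w]
  · rw [Category.assoc, Category.assoc, hq₂, ← 𝔡.r₁.naturality_assoc, ← 𝔡.r₂.naturality_assoc,
      T.w]

/-- Solutions at all objects between which all morphisms descend form a solution in the functor
category; functoriality is forced by uniqueness of descended morphisms. -/
lemma exists_functor (hp : ∀ j, MapsDetected (p.app j)) (S : ∀ j, LocalSolution 𝔡 j)
    (h : ∀ ⦃i j : J⦄ (g : i ⟶ j), ∃ φ, IsDescended (S i) (S j) g φ) :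
    ∃ D : J ⥤ B, (∃ (d : D ⟶ Y) (q : c₀ ⟶ D), 𝔡.IsSolution d q) ∧
      ∀ ⦃v i j k : J⦄ (α : v ⟶ i) (β : v ⟶ j) (α' : i ⟶ k) (β' : j ⟶ k) (a b a' b'),
        IsDescended (S v) (S i) α a → IsDescended (S v) (S j) β b →
        IsDescended (S i) (S k) α' a' → IsDescended (S j) (S k) β' b' →
        IsPullback a b a' b' → IsPullback (D.map α) (D.map β) (D.map α') (D.map β') := by
  choose φ hφ using h
  refine ⟨
    { obj j := (S j).D
      map g := φ g
      map_id i := (hφ (𝟙 i)).unique (hp i) (.id _)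
      map_comp g g' := (hφ (g ≫ g')).unique (hp _) ((hφ g).comp (hφ g')) },
    ⟨{ app j := (S j).d, naturality _ _ g := (hφ g).comp_d },
      { app j := (S j).q, naturality _ _ g := (hφ g).q_comp.symm },
      .of_forall_isPullback_app fun j => (S j).isPullback, by ext j; exact (S j).w⟩, ?_⟩
  intro v i j k α β α' β' a b a' b' ha hb ha' hb' H
  dsimp only
  rwa [(hφ α).unique (hp _) ha, (hφ β).unique (hp _) hb, (hφ α').unique (hp _) ha',
    (hφ β').unique (hp _) hb']

end Data

end FunctorCategory

/-! ### Arrow categories -/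

section Arrow

variable {B : Type u} [Category.{v} B]

lemma isPullback_arrow {W X Y Z : Arrow B} {f : W ⟶ X} {g : W ⟶ Y} {h : X ⟶ Z} {k : Y ⟶ Z}
    (H₁ : IsPullback f.left g.left h.left k.left)
    (H₂ : IsPullback f.right g.right h.right k.right) : IsPullback f g h k := by
  refine IsPullback.mk' ?_ (fun S φ φ' h₁ h₂ => ?_) (fun S a b hab => ?_)
  · ext
    · exact H₁.w
    · exact H₂.w
  · ext
    · exact H₁.hom_ext (congrArg (·.left) h₁) (congrArg (·.left) h₂)
    · exact H₂.hom_ext (congrArg (·.right) h₁) (congrArg (·.right) h₂)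
  · obtain ⟨l, hl₁, hl₂⟩ := H₁.exists_lift a.left b.left (congrArg (·.left) hab)
    obtain ⟨m, hm₁, hm₂⟩ := H₂.exists_lift a.right b.right (congrArg (·.right) hab)
    refine ⟨Arrow.homMk l m (H₂.hom_ext ?_ ?_), ?_, ?_⟩
    · rw [Category.assoc, Category.assoc, hm₁, ← Arrow.w f, reassoc_of% hl₁, Arrow.w a]
    · rw [Category.assoc, Category.assoc, hm₂, ← Arrow.w g, reassoc_of% hl₂, Arrow.w b]
    · ext
      · exact hl₁
      · exact hm₁
    · ext
      · exact hl₂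
      · exact hm₂

variable [HasPullbacks B]

lemma exists_isPullback_arrow {X Y Z : Arrow B} (f : X ⟶ Z) (g : Y ⟶ Z) :
    ∃ (W : Arrow B) (fst : W ⟶ X) (snd : W ⟶ Y),
      IsPullback fst.left snd.left f.left g.left ∧
        IsPullback fst.right snd.right f.right g.right := by
  have hl := IsPullback.of_hasPullback f.left g.left
  have hr := IsPullback.of_hasPullback f.right g.right
  obtain ⟨w, hw₁, hw₂⟩ := hr.exists_lift (pullback.fst f.left g.left ≫ X.hom)
    (pullback.snd f.left g.left ≫ Y.hom) (by
      rw [Category.assoc, Category.assoc, ← Arrow.w f, ← Arrow.w g, reassoc_of% hl.w])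
  exact ⟨Arrow.mk w, Arrow.homMk _ _ hw₁.symm, Arrow.homMk _ _ hw₂.symm, hl, hr⟩

instance preservesPullbacks_leftFunc :
    PreservesLimitsOfShape WalkingCospan (Arrow.leftFunc (C := B)) :=
  preservesLimitsOfShape_walkingCospan_of_forall_isPullback fun _ _ _ f g _ =>
    have ⟨W, fst, snd, h₁, h₂⟩ := exists_isPullback_arrow f g
    ⟨W, fst, snd, isPullback_arrow h₁ h₂, h₁⟩

instance preservesPullbacks_rightFunc :
    PreservesLimitsOfShape WalkingCospan (Arrow.rightFunc (C := B)) :=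
  preservesLimitsOfShape_walkingCospan_of_forall_isPullback fun _ _ _ f g _ =>
    have ⟨W, fst, snd, h₁, h₂⟩ := exists_isPullback_arrow f g
    ⟨W, fst, snd, isPullback_arrow h₁ h₂, h₂⟩

variable {x y : Arrow B} {p : x ⟶ y}

lemma mapsDetected_arrow (h₁ : MapsDetected p.left) (h₂ : MapsDetected p.right) :
    MapsDetected p := by
  intro A P Z q π a hq z f g hf hg hfg
  ext
  · exact h₁ (hq.map Arrow.leftFunc) (congrArg (·.left) hf) (congrArg (·.left) hg)
      (congrArg (·.left) hfg)
  · exact h₂ (hq.map Arrow.rightFunc) (congrArg (·.right) hf) (congrArg (·.right) hg)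
      (congrArg (·.right) hfg)

lemma mapsDescend_arrow (h₀ : MapsDetected p.left) (h₁ : MapsDescend p.left)
    (h₂ : MapsDescend p.right) : MapsDescend p := by
  intro A P Z q π a hq z ψ hψ hr
  have hq₁ : IsPullback q.left π.left a.left p.left := hq.map Arrow.leftFunc
  obtain ⟨f, hf, hf'⟩ := h₁ hq₁ (z := z.left) ψ.left (congrArg (·.left) hψ)
    (eq_of_map_eq Arrow.leftFunc hr)
  have hq₂ : IsPullback q.right π.right a.right p.right := hq.map Arrow.rightFunc
  obtain ⟨g, hg, hg'⟩ := h₂ hq₂ (z := z.right) ψ.right (congrArg (·.right) hψ)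
    (eq_of_map_eq Arrow.rightFunc hr)
  refine ⟨Arrow.homMk f g ?_, ?_, ?_⟩
  · refine h₀.eq_of_comp_eq hq₁ (w := y.hom) (z := z.right) ?_ ?_ ?_
    · rw [Category.assoc, ← Arrow.w z, reassoc_of% hf']
    · rw [Category.assoc, hg', Arrow.w a]
    · rw [reassoc_of% hf, Arrow.w ψ, Arrow.w_assoc q, hg]
  · ext
    · exact hf
    · exact hg
  · ext
    · exact hf'
    · exact hg'

end Arrow

/-! ### The sketch -/

namespace Sk

lemma d1_d0 : arr .d0_2 ≫ arr .d1_1 = arr .d2_2 ≫ arr .td0_1 :=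
  CategoryTheory.Quotient.sound Rel Rel.d1_d0

lemma d2_d0 : arr .d0_3 ≫ arr .d2_2 = arr .d3_3 ≫ arr .td0_2 :=
  CategoryTheory.Quotient.sound Rel Rel.d2_d0

lemma d2_d2 : arr .d2_3 ≫ arr .d2_2 = arr .d3_3 ≫ arr .td2_2 ≫ arr .m_1 :=
  CategoryTheory.Quotient.sound Rel Rel.d2_d2

lemma td1_d3 : arr .d3_3 ≫ arr .td1_2 = arr .d1_3 ≫ arr .d2_2 :=
  CategoryTheory.Quotient.sound Rel Rel.td1_d3

lemma d0_d1_3 : arr .d1_3 ≫ arr .d0_2 = arr .d0_3 ≫ arr .d0_2 :=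
  CategoryTheory.Quotient.sound Rel Rel.d0_d1_3

lemma d0_d2_3 : arr .d2_3 ≫ arr .d0_2 = arr .d0_3 ≫ arr .d1_2 :=
  CategoryTheory.Quotient.sound Rel Rel.d0_d2_3

lemma td1_td0 : arr .td0_2 ≫ arr .td1_1 = arr .td2_2 ≫ arr .ttd0_1 :=
  CategoryTheory.Quotient.sound Rel Rel.td1_td0

/-- A property of morphisms of `𝒮` that is closed under composition holds for all morphisms once
it holds for identities and generators. -/
lemma hom_induction {motive : ∀ ⦃i j : Sk⦄, (i ⟶ j) → Prop} (id_mem : ∀ i, motive (𝟙 i))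
    (comp : ∀ ⦃i j k : Sk⦄ (g : i ⟶ j) (g' : j ⟶ k), motive g → motive g' → motive (g ≫ g'))
    (arr : ∀ ⦃a b : Vert⦄ (g : Edge a b), motive (Sk.arr g)) ⦃i j : Sk⦄ (g : i ⟶ j) :
    motive g := by
  refine CategoryTheory.Quotient.induction (r := Rel) (P := fun g => motive g) (fun f => ?_) g
  refine Paths.induction (fun f => motive ((CategoryTheory.Quotient.functor Rel).map f)) ?_ ?_ f
  · intro v
    rw [CategoryTheory.Functor.map_id]
    exact id_mem _
  · intro u v w f e hf
    rw [CategoryTheory.Functor.map_comp]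
    exact comp _ _ hf (arr e)

end Sk

section Models

variable {B : Type u} [Category.{v} B] [HasPullbacks B]

lemma isModel_of_isPullback {W X Y Z : Sk ⥤ B} {fst : W ⟶ X} {snd : W ⟶ Y} {f : X ⟶ Z}
    {g : Y ⟶ Z} (h : IsPullback fst snd f g) (hX : IsModel B X) (hY : IsModel B Y)
    (hZ : IsModel B Z) : IsModel B W :=
  ⟨isPullback_map_of_isPullback h Sk.d1_d0 hX.1 hY.1 hZ.1,
    isPullback_map_of_isPullback h Sk.d2_d0 hX.2.1 hY.2.1 hZ.2.1,
    isPullback_map_of_isPullback h Sk.td1_td0 hX.2.2 hY.2.2 hZ.2.2⟩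

lemma exists_isPullback_model {X Y Z : Mod B} (f : X ⟶ Z) (g : Y ⟶ Z) :
    ∃ (W : Mod B) (fst : W ⟶ X) (snd : W ⟶ Y), IsPullback ((IsModel B).ι.map fst)
      ((IsModel B).ι.map snd) ((IsModel B).ι.map f) ((IsModel B).ι.map g) := by
  have h := IsPullback.of_hasPullback ((IsModel B).ι.map f) ((IsModel B).ι.map g)
  let W : Mod B := ⟨_, isModel_of_isPullback h X.property Y.property Z.property⟩
  exact ⟨W, ObjectProperty.homMk (X := W) (pullback.fst _ _),
    ObjectProperty.homMk (X := W) (pullback.snd _ _), h⟩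

instance hasPullbacks_mod : HasPullbacks (Mod B) := by
  have (X Y Z : Mod B) (f : X ⟶ Z) (g : Y ⟶ Z) : HasLimit (cospan f g) := by
    obtain ⟨W, fst, snd, h⟩ := exists_isPullback_model f g
    exact (h.of_map_of_faithful (IsModel B).ι).hasPullback
  exact hasPullbacks_of_hasLimit_cospan _

instance preservesPullbacks_ι : PreservesLimitsOfShape WalkingCospan (IsModel B).ι :=
  preservesLimitsOfShape_walkingCospan_of_forall_isPullback fun X Y Z f g _ => by
    obtain ⟨W, fst, snd, h⟩ := exists_isPullback_model f g
    exact ⟨W, fst, snd, h.of_map_of_faithful (IsModel B).ι, h⟩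

/-! ### Effective descent for models -/

variable {X Y : Mod B} {p : X ⟶ Y}

/-- The component at a vertex of a morphism of models. -/
abbrev modComponent (p : X ⟶ Y) (a : Vert) : X.obj.obj (Sk.ob a) ⟶ Y.obj.obj (Sk.ob a) :=
  ((IsModel B).ι.map p).app (Sk.ob a)

lemma mapsDetected_mod (hp : ∀ a, MapsDetected (modComponent p a)) : MapsDetected p :=
  fun _ _ _ _ _ _ hq _ _ _ hf hg hfg => (IsModel B).ι.map_injective <|
    mapsDetected_of_app (fun j => hp j.as) (hq.map (IsModel B).ι)
      (congrArg (IsModel B).ι.map hf) (congrArg (IsModel B).ι.map hg)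
      (by simpa using congrArg (IsModel B).ι.map hfg)

/-- At `x₃` no descent of morphisms is needed: there the factorization is obtained from the
pullback square with vertex `x₃`. -/
lemma mapsDescend_mod (hp : ∀ a, MapsDetected (modComponent p a))
    (hp' : ∀ a, a ≠ .x3 → MapsDescend (modComponent p a)) : MapsDescend p := by
  intro A P Z q π a hq z ψ hψ hr
  have hqι := hq.map (IsModel B).ι
  have hψι : (IsModel B).ι.map ψ ≫ (IsModel B).ι.map z =
      (IsModel B).ι.map q ≫ (IsModel B).ι.map a := congrArg (IsModel B).ι.map hψ
  have happ (v : Vert) (hv : v ≠ .x3) := exists_app (j := Sk.ob v) hqι hψι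
    (eq_of_map_eq (IsModel B).ι hr) (hp' v hv)
  obtain ⟨f, hf₁, hf₂⟩ := exists_natTrans (ψ := (IsModel B).ι.map ψ) (z := (IsModel B).ι.map z)
    hqι (fun j => hp j.as) (by
    rintro ⟨v⟩
    by_cases hv : v = Vert.x3
    · subst hv
      obtain ⟨s, hs, hs'⟩ := happ .x2 (by simp)
      obtain ⟨t, ht, ht'⟩ := happ .tx2 (by simp)
      obtain ⟨r, hr, hr'⟩ := happ .tx1 (by simp)
      exact exists_app_of_isPullback Sk.d2_d0 Z.property.2.1 Y.property.2.1 hs hs' ht ht'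
        (app_naturality hqι (hp .x2) hs hs' hr hr' _)
        (app_naturality hqι (hp .tx2) ht ht' hr hr' _)
    · exact happ v hv)
  exact ⟨ObjectProperty.homMk f, (IsModel B).ι.map_injective hf₁,
    (IsModel B).ι.map_injective hf₂⟩

/-- The solutions at `x₀, x₁, x₀', x₁', x₀'', x₁''` are given; those at `x₂`, `x₂'` and `x₃` are
the pullbacks prescribed by the sketch. Of the generators, only those out of `x₃` do not descend
outright: `d₀` and `d₃` are projections, and `d₁` and `d₂` are determined by their composites
with the projections of `x₂`. -/
lemma dataDescend_mod (hp : ∀ a, MapsDetected (modComponent p a))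
    (hp' : ∀ a, a ≠ .x3 → MapsDescend (modComponent p a))
    (hp'' : ∀ a, a ≠ .x2 → a ≠ .tx2 → a ≠ .x3 → DataDescend (modComponent p a)) :
    DataDescend p := by
  intro c₀ c 𝔡'
  let 𝔡 := 𝔡'.map (IsModel B).ι
  have sol (a : Vert) (h₁ : a ≠ .x2) (h₂ : a ≠ .tx2) (h₃ : a ≠ .x3) :
      Nonempty (LocalSolution 𝔡 (Sk.ob a)) := (hp'' a h₁ h₂ h₃).nonempty_localSolution
  have lift {a b : Vert} (ha : a ≠ .x3) (S : LocalSolution 𝔡 (Sk.ob a))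
      (S' : LocalSolution 𝔡 (Sk.ob b)) (g : Sk.ob a ⟶ Sk.ob b) :
      ∃ φ, IsDescended S S' g φ := IsDescended.exists_of_mapsDescend (hp' a ha) S S' g
  obtain ⟨S0⟩ := sol .x0 (by simp) (by simp) (by simp)
  obtain ⟨S1⟩ := sol .x1 (by simp) (by simp) (by simp)
  obtain ⟨T0⟩ := sol .tx0 (by simp) (by simp) (by simp)
  obtain ⟨T1⟩ := sol .tx1 (by simp) (by simp) (by simp)
  obtain ⟨U0⟩ := sol .ttx0 (by simp) (by simp) (by simp)
  obtain ⟨U1⟩ := sol .ttx1 (by simp) (by simp) (by simp)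
  obtain ⟨d1_1, hd1_1⟩ := lift (by simp) S1 T0 (Sk.arr .d1_1)
  obtain ⟨td0_1, htd0_1⟩ := lift (by simp) T1 T0 (Sk.arr .td0_1)
  obtain ⟨td1_1, htd1_1⟩ := lift (by simp) T1 U0 (Sk.arr .td1_1)
  obtain ⟨ttd0_1, httd0_1⟩ := lift (by simp) U1 U0 (Sk.arr .ttd0_1)
  obtain ⟨S2, d0_2, d2_2, hd0_2, hd2_2, sq_S2⟩ := exists_localSolution_of_isPullback Sk.d1_d0
    c₀.property.1 X.property.1 Y.property.1 hd1_1 htd0_1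
  obtain ⟨T2, td0_2, td2_2, htd0_2, htd2_2, sq_T2⟩ := exists_localSolution_of_isPullback
    Sk.td1_td0 c₀.property.2.2 X.property.2.2 Y.property.2.2 htd1_1 httd0_1
  obtain ⟨S3, d0_3, d3_3, hd0_3, hd3_3, sq_S3⟩ := exists_localSolution_of_isPullback Sk.d2_d0
    c₀.property.2.1 X.property.2.1 Y.property.2.1 hd2_2 htd0_2
  obtain ⟨d1_2, hd1_2⟩ := lift (by simp) S2 S1 (Sk.arr .d1_2)
  obtain ⟨td1_2, htd1_2⟩ := lift (by simp) T2 T1 (Sk.arr .td1_2)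
  obtain ⟨m_1, hm_1⟩ := lift (by simp) U1 T1 (Sk.arr .m_1)
  have hd1_3 : ∃ φ, IsDescended S3 S2 (Sk.arr .d1_3) φ := by
    refine IsDescended.exists_of_isPullback (hp .x3) Sk.d1_d0 hd0_2 hd2_2 hd1_1 htd0_1 sq_S2 _ ?_ ?_
    · rw [Sk.d0_d1_3]; exact ⟨_, hd0_3.comp hd0_2⟩
    · rw [← Sk.td1_d3]; exact ⟨_, hd3_3.comp htd1_2⟩
  have hd2_3 : ∃ φ, IsDescended S3 S2 (Sk.arr .d2_3) φ := by
    refine IsDescended.exists_of_isPullback (hp .x3) Sk.d1_d0 hd0_2 hd2_2 hd1_1 htd0_1 sq_S2 _ ?_ ?_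
    · rw [Sk.d0_d2_3]; exact ⟨_, hd0_3.comp hd1_2⟩
    · rw [Sk.d2_d2]; exact ⟨_, hd3_3.comp (htd2_2.comp hm_1)⟩
  let S : ∀ a : Vert, LocalSolution 𝔡 (Sk.ob a)
    | .x0 => S0 | .x1 => S1 | .x2 => S2 | .x3 => S3 | .tx0 => T0 | .tx1 => T1 | .tx2 => T2
    | .ttx0 => U0 | .ttx1 => U1
  have hS : ∀ ⦃i j : Sk⦄ (g : i ⟶ j), ∃ φ, IsDescended (S i.as) (S j.as) g φ :=
    Sk.hom_induction (motive := fun i j g => ∃ φ, IsDescended (S i.as) (S j.as) g φ)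
      (fun i => ⟨_, .id _⟩) (fun i j k g g' ⟨_, h⟩ ⟨_, h'⟩ => ⟨_, h.comp h'⟩) (fun a b g => by
        by_cases ha : a = .x3
        · subst ha
          cases g
          · exact ⟨_, hd0_3⟩
          · exact hd1_3
          · exact hd2_3
          · exact ⟨_, hd3_3⟩
        · exact lift ha (S a) (S b) (Sk.arr g))
  obtain ⟨D, ⟨d, q, hq⟩, hD⟩ := exists_functor (𝔡 := 𝔡) (fun j : Sk => hp j.as)
    (fun j : Sk => S j.as) hS
  let D' : Mod B := ⟨D, hD _ _ _ _ _ _ _ _ hd0_2 hd2_2 hd1_1 htd0_1 sq_S2,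
    hD _ _ _ _ _ _ _ _ hd0_3 hd3_3 hd2_2 htd0_2 sq_S3,
    hD _ _ _ _ _ _ _ _ htd0_2 htd2_2 htd1_1 httd0_1 sq_T2⟩
  exact ⟨D', ObjectProperty.homMk (X := D') d, ObjectProperty.homMk (Y := D') q,
    IsPullback.of_map_of_faithful (IsModel B).ι hq.isPullback, (IsModel B).ι.map_injective hq.w⟩

/-- Effective descent for morphisms of models, from their components. -/
theorem isEffectiveDescent_mod (hp : ∀ a, MapsDetected (modComponent p a))
    (hp' : ∀ a, a ≠ .x3 → MapsDescend (modComponent p a))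
    (hp'' : ∀ a, a ≠ .x2 → a ≠ .tx2 → a ≠ .x3 → DataDescend (modComponent p a)) :
    IsEffectiveDescent p :=
  isEffectiveDescent_iff.2 ⟨inferInstance, mapsDetected_mod hp, mapsDescend_mod hp hp',
    dataDescend_mod hp hp' hp''⟩

/-! ### The functors between which the isomorphism is inserted -/

instance preservesPullbacks_resArrow {a b : Vert} (g : Edge a b) :
    PreservesLimitsOfShape WalkingCospan (resArrow B g) :=
  preservesLimitsOfShape_walkingCospan_of_forall_isPullback fun _ _ _ f f' _ =>
    have h := IsPullback.of_hasPullback f f'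
    ⟨_, _, _, h, isPullback_arrow (h.app (Sk.ob a)) (h.app (Sk.ob b))⟩

variable (T : CategoryTheory.Monad B) [PreservesLimitsOfShape WalkingCospan (T : B ⥤ B)]

instance preservesPullbacks_multArrow : PreservesLimitsOfShape WalkingCospan (multArrow T) :=
  preservesLimitsOfShape_walkingCospan_of_forall_isPullback fun _ _ _ f g _ =>
    have h := (IsPullback.of_hasPullback f g).map (T : B ⥤ B)
    ⟨_, _, _, IsPullback.of_hasPullback f g, isPullback_arrow (h.map (T : B ⥤ B)) h⟩

instance preservesPullbacks_unitArrow : PreservesLimitsOfShape WalkingCospan (unitArrow T) :=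
  preservesLimitsOfShape_walkingCospan_of_forall_isPullback fun _ _ _ f g _ =>
    have h := IsPullback.of_hasPullback f g
    ⟨_, _, _, h, isPullback_arrow h (h.map (T : B ⥤ B))⟩

omit [HasPullbacks B] in
lemma mapsDetected_resAll {F G : Sk ⥤ B} {α : F ⟶ G}
    (hT : MapsDetected ((resT B).map α))
    (hm₀ : MapsDetected ((resArrow B .m_0).map α)) (hm₁ : MapsDetected ((resArrow B .m_1).map α))
    (he₀ : MapsDetected ((resArrow B .e_0).map α)) (he₁ : MapsDetected ((resArrow B .e_1).map α)) :
    MapsDetected ((resAll B).map α) :=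
  mapsDetected_prod hT (mapsDetected_prod hm₀ (mapsDetected_prod hm₁ (mapsDetected_prod he₀ he₁)))

omit [HasPullbacks B] in
lemma mapsDescend_resAll {F G : Sk ⥤ B} {α : F ⟶ G}
    (hT : MapsDescend ((resT B).map α))
    (hm₀ : MapsDescend ((resArrow B .m_0).map α)) (hm₁ : MapsDescend ((resArrow B .m_1).map α))
    (he₀ : MapsDescend ((resArrow B .e_0).map α)) (he₁ : MapsDescend ((resArrow B .e_1).map α)) :
    MapsDescend ((resAll B).map α) :=
  mapsDescend_prod hT (mapsDescend_prod hm₀ (mapsDescend_prod hm₁ (mapsDescend_prod he₀ he₁)))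

end Models

end

end IntMulticat

theorem lemma4p3 {B : Type u} [Category.{v} B] [HasPullbacks B]
    (T : CategoryTheory.Monad B) (hT : IntMulticat.IsCartesianMonad T)
    {X Y : IntMulticat.P T} (p : X ⟶ Y) :
    (IntMulticat.IsEffectiveDescent (IntMulticat.modHom p) →
      IntMulticat.IsDescent ((IntMulticat.resT B).map (IntMulticat.diagHom p)) →
      IntMulticat.IsDescent ((IntMulticat.resArrow B .m_0).map (IntMulticat.diagHom p)) →
      IntMulticat.IsDescent ((IntMulticat.resArrow B .m_1).map (IntMulticat.diagHom p)) →
      IntMulticat.IsDescent ((IntMulticat.resArrow B .e_0).map (IntMulticat.diagHom p)) →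
      IntMulticat.IsDescent ((IntMulticat.resArrow B .e_1).map (IntMulticat.diagHom p)) →
      IntMulticat.IsEffectiveDescent p) ∧
    (IntMulticat.IsEffectiveDescent (IntMulticat.component p .x0) →
      IntMulticat.IsEffectiveDescent (IntMulticat.component p .x1) →
      IntMulticat.IsEffectiveDescent (IntMulticat.component p .tx0) →
      IntMulticat.IsEffectiveDescent (IntMulticat.component p .tx1) →
      IntMulticat.IsEffectiveDescent (IntMulticat.component p .ttx0) →
      IntMulticat.IsEffectiveDescent (IntMulticat.component p .ttx1) →
      IntMulticat.IsDescent (IntMulticat.component p .x2) →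
      IntMulticat.IsDescent (IntMulticat.component p .tx2) →
      IntMulticat.IsAlmostDescent (IntMulticat.component p .x3) →
      IntMulticat.IsEffectiveDescent p) := by
  have := hT.preserves
  constructor
  · intro h hT' hm₀ hm₁ he₀ he₁
    rw [IntMulticat.isDescent_iff] at hT' hm₀ hm₁ he₀ he₁
    exact IntMulticat.PsEq.isEffectiveDescent h
      (IntMulticat.mapsDetected_resAll hT'.2.1 hm₀.2.1 hm₁.2.1 he₀.2.1 he₁.2.1)
      (IntMulticat.mapsDescend_resAll hT'.2.2 hm₀.2.2 hm₁.2.2 he₀.2.2 he₁.2.2)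
  · intro h0 h1 ht0 ht1 htt0 htt1 h2 ht2 h3
    rw [IntMulticat.isEffectiveDescent_iff] at h0 h1 ht0 ht1 htt0 htt1
    rw [IntMulticat.isDescent_iff] at h2 ht2
    rw [IntMulticat.isAlmostDescent_iff] at h3
    have hdet : ∀ a, IntMulticat.MapsDetected (IntMulticat.component p a)
      | .x0 => h0.2.1 | .x1 => h1.2.1 | .x2 => h2.2.1 | .x3 => h3.2 | .tx0 => ht0.2.1
      | .tx1 => ht1.2.1 | .tx2 => ht2.2.1 | .ttx0 => htt0.2.1 | .ttx1 => htt1.2.1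
    have hdesc : ∀ a, a ≠ .x3 → IntMulticat.MapsDescend (IntMulticat.component p a)
      | .x0, _ => h0.2.2.1 | .x1, _ => h1.2.2.1 | .x2, _ => h2.2.2 | .x3, h => (h rfl).elim
      | .tx0, _ => ht0.2.2.1 | .tx1, _ => ht1.2.2.1 | .tx2, _ => ht2.2.2
      | .ttx0, _ => htt0.2.2.1 | .ttx1, _ => htt1.2.2.1
    have hdata : ∀ a, a ≠ .x2 → a ≠ .tx2 → a ≠ .x3 →
        IntMulticat.DataDescend (IntMulticat.component p a)
      | .x0, _, _, _ => h0.2.2.2 | .x1, _, _, _ => h1.2.2.2 | .x2, h, _, _ => (h rfl).elim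
      | .tx2, _, h, _ => (h rfl).elim | .x3, _, _, h => (h rfl).elim
      | .tx0, _, _, _ => ht0.2.2.2 | .tx1, _, _, _ => ht1.2.2.2
      | .ttx0, _, _, _ => htt0.2.2.2 | .ttx1, _, _, _ => htt1.2.2.2
    have hincl (a : IntMulticat.TVert) : a.incl ≠ .x3 := by
      cases a <;> simp [IntMulticat.TVert.incl]
    refine IntMulticat.PsEq.isEffectiveDescent
      (IntMulticat.isEffectiveDescent_mod hdet hdesc hdata)
      (IntMulticat.mapsDetected_resAll
        (IntMulticat.mapsDetected_of_app fun j => hdet j.as.incl) ?_ ?_ ?_ ?_)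
      (IntMulticat.mapsDescend_resAll
        (IntMulticat.mapsDescend_of_app (fun j => hdet j.as.incl)
          (fun j => hdesc _ (hincl j.as))) ?_ ?_ ?_ ?_)
    · exact IntMulticat.mapsDetected_arrow (hdet .ttx0) (hdet .tx0)
    · exact IntMulticat.mapsDetected_arrow (hdet .ttx1) (hdet .tx1)
    · exact IntMulticat.mapsDetected_arrow (hdet .x0) (hdet .tx0)
    · exact IntMulticat.mapsDetected_arrow (hdet .x1) (hdet .tx1)
    · exact IntMulticat.mapsDescend_arrow (hdet .ttx0) htt0.2.2.1 ht0.2.2.1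
    · exact IntMulticat.mapsDescend_arrow (hdet .ttx1) htt1.2.2.1 ht1.2.2.1
    · exact IntMulticat.mapsDescend_arrow (hdet .x0) h0.2.2.1 ht0.2.2.1
    · exact IntMulticat.mapsDescend_arrow (hdet .x1) h1.2.2.1 ht1.2.2.1
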